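/- **Setting.** Let $\mathcal M$ be a smooth finite-dimensional Riemannian manifold, $f_1,\dots,f_n:\mathcal M\to\mathbb R$ ($n\ge1$) twice continuously differentiable, and $f=\frac1n\sum_{i=1}^n f_i$. Let $R:T\mathcal M\to\mathcal M$ be a (smooth) retraction, and $\mathcal T$ an isometric vector transport associated with $R$: linear isometries $\mathcal T_\xi:T_x\mathcal M\to T_{R_x(\xi)}\mathcal M$ with $\mathcal T_{0_x}=\mathrm{id}$. Let $\mathcal X$ be a neighbourhood of a point $x^*$ that minimizes $f$ over $\mathcal X$, and suppose $\mathcal X$ is totally retractive: for each $x\in\mathcal X$, $R_x$ restricts to a diffeomorphism from an open neighbourhood of $0\in T_x\mathcal M$ onto an open set containing $\mathcal X$. Let $L>0$ and $L_l,\theta,G,\sigma\ge0$ be constants such that, for all $x\in\mathcal X$, $$\|\mathrm{grad}f_i(x)\|\le G\ (1\le i\le n),\qquad \frac1n\sum_{i=1}^n\|\mathrm{grad}f_i(x)-\mathrm{grad}f(x)\|^2\le\sigma^2,$$ and such that, for all $x\in\mathcal X$ and $\xi\in T_x\mathcal M$ whose retraction curve $c(t)=R_x(t\xi)$, $0\le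 t\le1$, stays in $\mathcal X$, with $y=R_x(\xi)$ and with $P_x^y$, $P_y^x=(P_x^y)^{-1}$ the (Levi-Civita) parallel transports along $c$, $$f(y)\le f(x)+\langle\mathrm{grad}f(x),\xi\rangle+\tfrac L2\|\xi\|^2,\qquad \frac1n\sum_{i=1}^n\|\mathrm{grad}f_i(x)-P_y^x\,\mathrm{grad}f_i(y)\|^2\le L_l^2\|\xi\|^2,$$ $$\|\mathcal T_\xi\zeta-P_x^y\zeta\|\le\theta\,\|\xi\|\,\|\zeta\|\quad\text{for all }\zeta\in T_x\mathcal M.$$ **Algorithm (vanilla R-SRG).** Given $\tilde x^0\in\mathcal M$, a step size $\eta>0$ and integers $S,m,b\ge1$, $1\le B\le n$, do for $s=1,\dots,S$: put $x_0^s=\tilde x^{s-1}$; draw a subset $\mathcal B^s\subset[n]$ of size $B$ uniformly without replacement; put $v_0^s=\mathrm{grad}f_{\mathcal B^s}(x_0^s)$ and $x_1^s=R_{x_0^s}(-\eta v_0^s)$; for $t=1,\dots,m-1$ draw $b$ indices $\mathcal I_t^s$ uniformly from $[n]$ with replacement and put $$v_t^s=\mathrm{grad}f_{\mathcal I_t^s}(x_t^s)-\mathcal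 T_{-\eta v_{t-1}^s}\big(\mathrm{grad}f_{\mathcal I_t^s}(x_{t-1}^s)-v_{t-1}^s\big),\qquad x_{t+1}^s=R_{x_t^s}(-\eta v_t^s);$$ then put $\tilde x^s=x_m^s$. Here $\mathrm{grad}f_{\mathcal I}$ is the average of $\mathrm{grad}f_i$ over $i\in\mathcal I$ (with multiplicity). All draws are independent. The output $\tilde x$ is uniformly distributed over the $x_t^s$, $1\le s\le S$, $0\le t\le m-1$, independently of the samples. Each evaluation of some $\mathrm{grad}f_i$ at some point made by the algorithm is one IFO call. It is assumed that the iterates stay continuously in $\mathcal X$: whatever samples are drawn, the curves $R_{x_t^s}(-\tau\eta v_t^s)$, $0\le\tau\le1$, lie in $\mathcal X$ (in part 1 for the given $S$, in parts 2 and 3 for every number $S$ of epochs). Put $\Delta=f(\tilde x^0)-f(x^*)$ and $\Theta_2=L+\sqrt{L^2+4(L_l+\theta G)^2}$. **Claim.** 1. (Convergence.) If $0<\eta\le\dfrac{2}{L+\sqrt{L^2+4\frac{(L_l+\theta G)^2m}{b}}}$, then with $T=Sm$ $$\mathbb E\|\mathrm{grad}f(\tilde x)\|^2\le\frac{2\Delta}{T\eta}+\mathbb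 1_{\{B<n\}}\frac{\sigma^2}{B}.$$ There is moreover an absolute constant $C>0$ (independent of the manifold and of all other data above) such that, with $\eta=2/\Theta_2$, the following hold. 2. (Finite-sum.) Let $\epsilon>0$, $B=n$ and $b=m=\lfloor\sqrt n\rfloor$. Then there is a number $S\ge1$ of epochs for which $\mathbb E\|\mathrm{grad}f(\tilde x)\|\le\epsilon$ and the total number of IFO calls is at most $$C\Big(n+\frac{\Delta\,\Theta_2\sqrt n}{\epsilon^2}\Big).$$ 3. (Online.) Let $0<\epsilon\le\sigma$, $B=\lceil2\sigma^2/\epsilon^2\rceil\le n$ and $b=m=\lceil\sigma/\epsilon\rceil$. Then there is a number $S\ge1$ of epochs for which $\mathbb E\|\mathrm{grad}f(\tilde x)\|\le\epsilon$ and the total number of IFO calls is at most $C\big(\frac{\sigma^2}{\epsilon^2}+\frac{\Delta\,\Theta_2\,\sigma}{\epsilon^3}\big)$; if moreover $\sigma\epsilon\le\Delta\,\Theta_2$, it is at most $$C\,\frac{\Delta\,\Theta_2\,\sigma}{\epsilon^3}.$$ -/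

import Mathlib

open Set Bundle Manifold
open scoped ContDiff Topology BigOperators

universe u v

noncomputable section

namespace RiemannianSRG

section Geometry

variable {E : Type u} [NormedAddCommGroup E] [NormedSpace ℝ E]
  {M : Type v} [TopologicalSpace M] [ChartedSpace E M]

/-- The velocity `c'(t)` of a curve in `M`. -/
def velocity (c : ℝ → M) (t : ℝ) : TangentSpace 𝓘(ℝ, E) (c t) :=
  mfderiv 𝓘(ℝ, ℝ) 𝓘(ℝ, E) c t (1 : ℝ)

variable (E M) in
/-- A retraction: a smooth map `R : TM → M` such that the curve `t ↦ R_x(t ξ)` starts at `x` with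
velocity `ξ`, that is, `R_x(0) = x` and `D R_x(0)[ξ] = ξ`. -/
structure Retraction [IsManifold 𝓘(ℝ, E) ∞ M] where
  toFun : (x : M) → TangentSpace 𝓘(ℝ, E) x → M
  contMDiff' : ContMDiff 𝓘(ℝ, E).tangent 𝓘(ℝ, E) ∞
    (fun p : TangentBundle 𝓘(ℝ, E) M ↦ toFun p.1 p.2)
  velocity_zero' : ∀ (x : M) (ξ : TangentSpace 𝓘(ℝ, E) x),
    (⟨toFun x ((0 : ℝ) • ξ), velocity (E := E) (fun t : ℝ ↦ toFun x (t • ξ)) 0⟩ :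
      TangentBundle 𝓘(ℝ, E) M) = ⟨x, ξ⟩

variable [IsManifold 𝓘(ℝ, E) ∞ M]

/-- The retraction curve `t ↦ R_x(t ξ)`. -/
def Retraction.curve (R : Retraction E M) (x : M) (ξ : TangentSpace 𝓘(ℝ, E) x) (t : ℝ) : M :=
  R.toFun x (t • ξ)

/-- The retraction curve `R_x(t ξ)`, `0 ≤ t ≤ 1`, stays in `X`. -/
def Retraction.SegmentIn (R : Retraction E M) (X : Set M) (x : M)
    (ξ : TangentSpace 𝓘(ℝ, E) x) : Prop :=
  ∀ t ∈ Icc (0 : ℝ) 1, R.curve x ξ t ∈ X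

variable [RiemannianBundle (fun x : M ↦ TangentSpace 𝓘(ℝ, E) x)]

/-- `X` is totally retractive: around every `x ∈ X`, `R_x` restricts to a diffeomorphism from an
open neighbourhood of `0` in `T_x M` onto an open set containing `X`. (`R_x` itself is smooth.) -/
def Retraction.IsTotallyRetractive (R : Retraction E M) (X : Set M) : Prop :=
  ∀ x ∈ X, ∃ e : OpenPartialHomeomorph (TangentSpace 𝓘(ℝ, E) x) M,
    (0 : TangentSpace 𝓘(ℝ, E) x) ∈ e.source ∧ X ⊆ e.target ∧ EqOn e (R.toFun x) e.source ∧
      MDifferentiableOn 𝓘(ℝ, E) 𝓘(ℝ, TangentSpace 𝓘(ℝ, E) x) e.symm e.target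

/-- An isometric vector transport associated with `R`: linear isometries
`T_ξ : T_x M → T_{R_x(ξ)} M` with `T_0 = id`. -/
structure VectorTransport (R : Retraction E M) where
  toFun : (x : M) → (ξ : TangentSpace 𝓘(ℝ, E) x) →
    (TangentSpace 𝓘(ℝ, E) x →ₗᵢ[ℝ] TangentSpace 𝓘(ℝ, E) (R.toFun x ξ))
  map_zero' : ∀ (x : M) (v : TangentSpace 𝓘(ℝ, E) x),
    (⟨R.toFun x 0, toFun x 0 v⟩ : TangentBundle 𝓘(ℝ, E) M) = ⟨x, v⟩

variable [FiniteDimensional ℝ E]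

/-- The Riemannian gradient: `⟨grad f(x), w⟩ = D f(x)[w]` for all `w ∈ T_x M`. -/
def grad (f : M → ℝ) (x : M) : TangentSpace 𝓘(ℝ, E) x :=
  haveI : FiniteDimensional ℝ (TangentSpace 𝓘(ℝ, E) x) := inferInstanceAs (FiniteDimensional ℝ E)
  haveI : CompleteSpace (TangentSpace 𝓘(ℝ, E) x) := FiniteDimensional.complete ℝ _
  (InnerProductSpace.toDual ℝ (TangentSpace 𝓘(ℝ, E) x)).symm (mvfderiv 𝓘(ℝ, E) f x)

theorem inner_grad (f : M → ℝ) (x : M) (w : TangentSpace 𝓘(ℝ, E) x) :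
    inner ℝ (grad f x) w = mvfderiv 𝓘(ℝ, E) f x w := by
  have : FiniteDimensional ℝ (TangentSpace 𝓘(ℝ, E) x) := inferInstanceAs (FiniteDimensional ℝ E)
  have : CompleteSpace (TangentSpace 𝓘(ℝ, E) x) := FiniteDimensional.complete ℝ _
  unfold grad
  exact InnerProductSpace.toDual_symm_apply ..

/-- `cov` is the Levi-Civita connection: torsion-free and compatible with the metric,
`w⟨Y, Z⟩ = ⟨∇_w Y, Z⟩ + ⟨Y, ∇_w Z⟩`. (`cov Y x w` is `∇_w Y` at `x`.) -/
structure IsLeviCivita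
    (cov : CovariantDerivative 𝓘(ℝ, E) E (fun x : M ↦ TangentSpace 𝓘(ℝ, E) x)) : Prop where
  torsion_free : cov.torsion = 0
  metric : ∀ (x : M) (w : TangentSpace 𝓘(ℝ, E) x) (Y Z : (y : M) → TangentSpace 𝓘(ℝ, E) y),
    MDiffAt (T% Y) x → MDiffAt (T% Z) x →
      mvfderiv 𝓘(ℝ, E) (fun y ↦ inner ℝ (Y y) (Z y)) x w
        = inner ℝ (cov Y x w) (Z x) + inner ℝ (Y x) (cov Z x w)

/-- Coordinates of a tangent vector `v ∈ T_y M` in the local frame of `TM` around `x` given by the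
preferred trivialization at `x`. -/
def coords (x : M) {y : M} (v : TangentSpace 𝓘(ℝ, E) y) : E :=
  (trivializationAt E (fun z : M ↦ TangentSpace 𝓘(ℝ, E) z) x ⟨y, v⟩).2

/-- `V` is a parallel vector field along the curve `c` over `[0, 1]`, i.e. `D_t V = 0`. In the local
frame around `c(t)`, the covariant derivative of `V` at time `t` has coordinates
`(d/dt) V + ∇_{c'(t)} (V(t))~`, where `(V(t))~` is the field with the constant coordinates
of `V(t)`. -/
def IsParallelAlong (cov : CovariantDerivative 𝓘(ℝ, E) E (fun x : M ↦ TangentSpace 𝓘(ℝ, E) x))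
    (c : ℝ → M) (V : (t : ℝ) → TangentSpace 𝓘(ℝ, E) (c t)) : Prop :=
  ∀ t ∈ Icc (0 : ℝ) 1,
    HasDerivWithinAt (fun r ↦ coords (c t) (V r))
      (-coords (c t) (cov (FiberBundle.extend E (V t)) (c t) (velocity c t))) (Icc 0 1) t

/-- `q` is the parallel transport of `p` along `c` from time `0` to time `1` (equivalently, `p` is
the parallel transport of `q` backwards along `c`). -/
def IsParallelTransport
    (cov : CovariantDerivative 𝓘(ℝ, E) E (fun x : M ↦ TangentSpace 𝓘(ℝ, E) x))
    (c : ℝ → M) (p q : TangentBundle 𝓘(ℝ, E) M) : Prop :=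
  ∃ V : (t : ℝ) → TangentSpace 𝓘(ℝ, E) (c t),
    IsParallelAlong cov c V ∧ (⟨c 0, V 0⟩ : TangentBundle 𝓘(ℝ, E) M) = p ∧
      (⟨c 1, V 1⟩ : TangentBundle 𝓘(ℝ, E) M) = q

/-- The objective `f = (1/n) ∑ f_i`. -/
def avg {n : ℕ} (f : Fin n → M → ℝ) (x : M) : ℝ := (1 / (n : ℝ)) * ∑ i, f i x

/-- The standing assumptions on the objective, the retraction and the vector transport. `X` is a
neighbourhood of the point `xs`, which minimizes `f` over `X`. The last three conditions are only
asked for pairs `x`, `y = R_x(ξ)` that are joined inside `X` by the retraction curve. -/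
structure Assumptions {n : ℕ}
    (cov : CovariantDerivative 𝓘(ℝ, E) E (fun x : M ↦ TangentSpace 𝓘(ℝ, E) x))
    (f : Fin n → M → ℝ) (R : Retraction E M) (T : VectorTransport R) (X : Set M) (xs : M)
    (L Ll θ G σ : ℝ) : Prop where
  contMDiff : ∀ i, ContMDiff 𝓘(ℝ, E) 𝓘(ℝ, ℝ) 2 (f i)
  mem_nhds : X ∈ 𝓝 xs
  optimal : IsMinOn (avg f) X xs
  retractive : R.IsTotallyRetractive X
  grad_le : ∀ i, ∀ x ∈ X, ‖grad (E := E) (f i) x‖ ≤ G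
  variance_le : ∀ x ∈ X,
    (1 / (n : ℝ)) * ∑ i, ‖grad (E := E) (f i) x - grad (E := E) (avg f) x‖ ^ 2 ≤ σ ^ 2
  /-- retraction `L`-smoothness -/
  smooth : ∀ (x : M) (ξ : TangentSpace 𝓘(ℝ, E) x), R.SegmentIn X x ξ →
    avg f (R.toFun x ξ) ≤ avg f x + inner ℝ (grad (avg f) x) ξ + L / 2 * ‖ξ‖ ^ 2
  /-- average (mean-square) retraction `Ll`-Lipschitz gradients; `u i` is the parallel transport
  of `grad f_i(R_x(ξ))` back to `x` along the retraction curve -/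
  lipschitz : ∀ (x : M) (ξ : TangentSpace 𝓘(ℝ, E) x), R.SegmentIn X x ξ →
    ∃ u : Fin n → TangentSpace 𝓘(ℝ, E) x,
      (∀ i, IsParallelTransport cov (R.curve x ξ) ⟨x, u i⟩
        ⟨R.toFun x ξ, grad (f i) (R.toFun x ξ)⟩) ∧
      (1 / (n : ℝ)) * ∑ i, ‖grad (f i) x - u i‖ ^ 2 ≤ (Ll * ‖ξ‖) ^ 2
  /-- the vector transport is `θ`-close to the parallel transport along the retraction curve -/
  transport : ∀ (x : M) (ξ : TangentSpace 𝓘(ℝ, E) x), R.SegmentIn X x ξ →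
    ∀ ζ : TangentSpace 𝓘(ℝ, E) x, ∃ w : TangentSpace 𝓘(ℝ, E) (R.toFun x ξ),
      IsParallelTransport cov (R.curve x ξ) ⟨x, ζ⟩ ⟨R.toFun x ξ, w⟩ ∧
      ‖T.toFun x ξ ζ - w‖ ≤ θ * ‖ξ‖ * ‖ζ‖

end Geometry

section Algorithm

/-- The random samples of one epoch: a subset of `[n]` of size `B` (drawn without replacement) and,
for each inner iteration `t = 1, …, m - 1`, a tuple of `b` indices (drawn with replacement). -/
abbrev EpochSample (n B m b : ℕ) : Type :=
  {A : Finset (Fin n) // A.card = B} × (Fin (m - 1) → Fin b → Fin n)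

/-- The random choices of a run with `S` epochs: the samples of all epochs, and the pair `(s, t)`
of the iterate `x_t^s` that is output. All choices are independent and uniform, that is, uniformly
distributed on this finite type. -/
abbrev RunSample (n B m b S : ℕ) : Type := (Fin S → EpochSample n B m b) × (Fin S × Fin m)

variable {E : Type u} [NormedAddCommGroup E] [NormedSpace ℝ E]
  {M : Type v} [TopologicalSpace M] [ChartedSpace E M]

variable (E M) in
/-- The state of the algorithm: the iterate `x_t^s`, the modified gradient `v_t^s`, and the
number of oracle calls made so far. -/
structure State where
  point : M
  dir : TangentSpace 𝓘(ℝ, E) point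
  calls : ℕ

variable [IsManifold 𝓘(ℝ, E) ∞ M] [RiemannianBundle (fun x : M ↦ TangentSpace 𝓘(ℝ, E) x)]
  [FiniteDimensional ℝ E]

/-- One call of the incremental first-order oracle per entry `i` of the list, at the point `x`;
returns the sum of the answers `grad f_i(x)` and the number of calls. -/
def query {n : ℕ} (f : Fin n → M → ℝ) (x : M) : List (Fin n) → TangentSpace 𝓘(ℝ, E) x × ℕ
  | [] => (0, 0)
  | i :: l => (grad (f i) x + (query f x l).1, (query f x l).2 + 1)

/-- The mini-batch gradient over a list of indices, with the number of oracle calls. -/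
def batchGrad {n : ℕ} (f : Fin n → M → ℝ) (x : M) (l : List (Fin n)) :
    TangentSpace 𝓘(ℝ, E) x × ℕ :=
  ((l.length : ℝ)⁻¹ • (query (E := E) f x l).1, (query (E := E) f x l).2)

variable {n : ℕ} (f : Fin n → M → ℝ) (R : Retraction E M) (T : VectorTransport R) (η : ℝ)

/-- The update `-η v` at a state. -/
def State.step (p : State E M) : TangentSpace 𝓘(ℝ, E) p.point := -(η • p.dir)

/-- One inner iteration with mini-batch `l`: `x' = R_x(-η v)` and
`v' = grad f_l(x') - T_{-η v} (grad f_l(x) - v)`. -/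
def innerStep (p : State E M) (l : List (Fin n)) : State E M where
  point := R.toFun p.point (p.step η)
  dir := (batchGrad f (R.toFun p.point (p.step η)) l).1
    - T.toFun p.point (p.step η) ((batchGrad f p.point l).1 - p.dir)
  calls := p.calls + (batchGrad (E := E) f (R.toFun p.point (p.step η)) l).2
    + (batchGrad (E := E) f p.point l).2

variable {B m b S : ℕ}

/-- The state at the inner iteration `t` (`t ≤ m - 1`) of an epoch started at `x`, after `k` oracle
calls in the earlier epochs. -/
def epochState (x : M) (k : ℕ) (κ : EpochSample n B m b) : ℕ → State E M
  | 0 => ⟨x, (batchGrad f x κ.1.1.toList).1, k + (batchGrad (E := E) f x κ.1.1.toList).2⟩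
  | t + 1 =>
    if h : t < m - 1 then
      innerStep f R T η (epochState x k κ t) (List.ofFn (κ.2 ⟨t, h⟩))
    else epochState x k κ t

/-- The point `x̃^s` (the last iterate `x_m^s` of epoch `s`, and the starting point of the next
epoch), with the number of oracle calls made so far; `x̃^0 = x₀`. -/
def snapshot (x₀ : M) (κ : Fin S → EpochSample n B m b) : ℕ → M × ℕ
  | 0 => (x₀, 0)
  | s + 1 =>
    if h : s < S then
      let p := epochState f R T η (snapshot x₀ κ s).1 (snapshot x₀ κ s).2 (κ ⟨s, h⟩) (m - 1)
      (R.toFun p.point (p.step η), p.calls)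
    else snapshot x₀ κ s

/-- The state at inner iteration `t` of epoch `s` (both counted from `0`). -/
def runState (x₀ : M) (κ : Fin S → EpochSample n B m b) (s : Fin S) (t : Fin m) : State E M :=
  epochState f R T η (snapshot f R T η x₀ κ s).1 (snapshot f R T η x₀ κ s).2 (κ s) t

/-- The output of a run: an iterate `x_t^s`, `0 ≤ t < m`, picked uniformly at random. -/
def output (x₀ : M) (κ : RunSample n B m b S) : M :=
  (runState f R T η x₀ κ.1 κ.2.1 κ.2.2).point

/-- The total number of oracle calls of a run. -/
def totalCalls (x₀ : M) (κ : RunSample n B m b S) : ℕ := (snapshot f R T η x₀ κ.1 S).2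

variable (B m b S) in
/-- Whatever samples are drawn, the iterates of a run with `S` epochs stay continuously in `X`: each
move from an iterate to the next one is along a retraction curve inside `X`. -/
def StaysIn (x₀ : M) (X : Set M) : Prop :=
  ∀ (κ : Fin S → EpochSample n B m b) (s : Fin S) (t : Fin m),
    R.SegmentIn X (runState f R T η x₀ κ s t).point ((runState f R T η x₀ κ s t).step η)

variable (B m b S) in
/-- `E ‖grad f(x̃)‖ ^ k` for the output `x̃`, the expectation being the average over the
finite type of all random choices. -/
def expGradPow (x₀ : M) (k : ℕ) : ℝ :=
  Finset.expect Finset.univ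
    (fun κ : RunSample n B m b S ↦ ‖grad (E := E) (avg f) (output f R T η x₀ κ)‖ ^ k)

end Algorithm

end RiemannianSRG

end

namespace RiemannianSRG

/-! The argument is the SARAH/SPIDER recursion carried over to tangent spaces. Let `e_t` be the
expected squared error of the direction `v_t` as an estimate of the full gradient, and `d_t` the
expected value of `‖v_t‖²`. The new error is the old error moved by the vector transport plus a
centred mini-batch mean of `grad f_i(x_{t+1}) - T grad f_i(x_t)`. The transport is isometric and
independence kills the cross term, so `e_{t+1} ≤ e_t + (Ll + θ G)² η² d_t / b`.

The constant `Ll + θ G` compares the vector transport with parallel transport: `Ll` is the Lipschitz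
constant of the gradients under parallel transport, and `θ G` is the price of using `T` instead.
This needs parallel transport, given only as a relation, to preserve norms and to have a unique
result; both follow from the constancy of `⟨V, W⟩` for parallel fields (`IsParallelAlong.inner_eq`).

Retraction smoothness gives `η/2 ‖grad f(x_t)‖² ≤ f(x_t) - f(x_{t+1}) + η/2 (error) - (η/2 - L η²/2)
‖v_t‖²`. Summed over an epoch, the accumulated error is paid for by the negative `d_t` terms exactly
when `(Ll + θ G)² η² m / b + L η ≤ 1`, which the step-size bound ensures. Only the initial batch
error survives: at most `σ²/B`, and zero if `B = n`. Objective values telescope over the epochs and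
are bounded below by the minimum over `X`.

For the complexity claims the number of epochs makes the second moment at most `ε²`, Jensen passes
to the first moment, and the deterministic number of oracle calls is estimated. -/

/-- Product rule for a bilinear form that varies with time, evaluated on two moving vectors. -/
theorem hasDerivWithinAt_bilinear {E : Type*} [NormedAddCommGroup E] [NormedSpace ℝ E]
    [FiniteDimensional ℝ E] {s : Set ℝ} {t : ℝ} (hs : UniqueDiffWithinAt ℝ s t)
    {Bil : ℝ → E →ₗ[ℝ] E →ₗ[ℝ] ℝ} {D : E → E → ℝ}
    (hB : ∀ a b, HasDerivWithinAt (fun r ↦ Bil r a b) (D a b) s t)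
    {a b : ℝ → E} {a' b' : E} (ha : HasDerivWithinAt a a' s t) (hb : HasDerivWithinAt b b' s t) :
    HasDerivWithinAt (fun r ↦ Bil r (a r) (b r))
      (D (a t) (b t) + Bil t a' (b t) + Bil t (a t) b') s t := by
  classical
  let β := Module.finBasis ℝ E
  have expand : ∀ r (x y : E), Bil r x y
      = ∑ i, ∑ j, β.repr x i * (β.repr y j * Bil r (β i) (β j)) := by
    intro r x y
    conv_lhs => rw [← β.sum_repr x, ← β.sum_repr y]
    simp only [map_sum, map_smul, LinearMap.sum_apply, LinearMap.smul_apply, smul_eq_mul,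
      Finset.mul_sum]
    rw [Finset.sum_comm]
    exact Finset.sum_congr rfl fun i _ ↦ Finset.sum_congr rfl fun j _ ↦ by ring
  have coordDeriv : ∀ (x : ℝ → E) (x' : E), HasDerivWithinAt x x' s t → ∀ i,
      HasDerivWithinAt (fun r ↦ β.repr (x r) i) (β.repr x' i) s t := by
    intro x x' hx i
    exact ((β.coord i).toContinuousLinearMap.hasFDerivAt.comp_hasDerivWithinAt t hx)
  -- Bilinearity of `D` is not assumed: uniqueness of derivatives forces it to have the same basis
  -- expansion as the forms `Bil r`.
  have hD : ∀ x y, D x y = ∑ i, ∑ j, β.repr x i * (β.repr y j * D (β i) (β j)) := by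
    intro x y
    refine hs.eq_deriv s (hB x y) ?_
    simp_rw [expand _ x y]
    exact HasDerivWithinAt.fun_sum fun i _ ↦ HasDerivWithinAt.fun_sum fun j _ ↦
      ((hB _ _).const_mul _).const_mul _
  simp_rw [fun r ↦ expand r (a r) (b r)]
  refine (HasDerivWithinAt.fun_sum fun i (_ : i ∈ Finset.univ) ↦
    HasDerivWithinAt.fun_sum fun j (_ : j ∈ Finset.univ) ↦
    (coordDeriv a a' ha i).fun_mul ((coordDeriv b b' hb j).fun_mul (hB (β i) (β j)))).congr_deriv ?_
  rw [hD, expand, expand, ← Finset.sum_add_distrib, ← Finset.sum_add_distrib]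
  refine Finset.sum_congr rfl fun i _ ↦ ?_
  rw [← Finset.sum_add_distrib, ← Finset.sum_add_distrib]
  refine Finset.sum_congr rfl fun j _ ↦ ?_
  ring

/-! ### Retraction curves; parallel transport is isometric and single-valued. -/

section Geometry

variable {E : Type u} [NormedAddCommGroup E] [NormedSpace ℝ E]
  {M : Type v} [TopologicalSpace M] [ChartedSpace E M] [IsManifold 𝓘(ℝ, E) ∞ M]

theorem Retraction.toFun_zero (R : Retraction E M) (x : M) : R.toFun x 0 = x := by
  have h := congrArg TotalSpace.proj (R.velocity_zero' x 0)
  simpa using h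

theorem Retraction.curve_zero (R : Retraction E M) (x : M) (ξ : TangentSpace 𝓘(ℝ, E) x) :
    R.curve x ξ 0 = x := by
  unfold Retraction.curve
  rw [zero_smul, R.toFun_zero]

theorem Retraction.curve_one (R : Retraction E M) (x : M) (ξ : TangentSpace 𝓘(ℝ, E) x) :
    R.curve x ξ 1 = R.toFun x ξ := by
  unfold Retraction.curve
  rw [one_smul]

theorem Retraction.SegmentIn.left_mem {R : Retraction E M} {X : Set M} {x : M}
    {ξ : TangentSpace 𝓘(ℝ, E) x} (h : R.SegmentIn X x ξ) : x ∈ X := by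
  simpa [R.curve_zero] using h 0 (by simp)

theorem Retraction.SegmentIn.right_mem {R : Retraction E M} {X : Set M} {x : M}
    {ξ : TangentSpace 𝓘(ℝ, E) x} (h : R.SegmentIn X x ξ) : R.toFun x ξ ∈ X := by
  simpa [R.curve_one] using h 1 (by simp)

theorem Retraction.mdifferentiable_curve (R : Retraction E M) (x : M)
    (ξ : TangentSpace 𝓘(ℝ, E) x) : MDifferentiable 𝓘(ℝ, ℝ) 𝓘(ℝ, E) (R.curve x ξ) := by
  have hline : ContMDiff 𝓘(ℝ, ℝ) 𝓘(ℝ, E).tangent ∞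
      (fun r : ℝ ↦ (⟨x, r • ξ⟩ : TangentBundle 𝓘(ℝ, E) M)) := by
    intro r
    rw [contMDiffAt_totalSpace]
    refine ⟨contMDiffAt_const, ?_⟩
    have hx : x ∈ (trivializationAt E (TangentSpace 𝓘(ℝ, E)) x).baseSet :=
      FiberBundle.mem_baseSet_trivializationAt' x
    have h : ∀ r : ℝ, (trivializationAt E (TangentSpace 𝓘(ℝ, E)) x ⟨x, r • ξ⟩).2
        = r • (trivializationAt E (TangentSpace 𝓘(ℝ, E)) x ⟨x, ξ⟩).2 := by
      intro r
      exact ((trivializationAt E (TangentSpace 𝓘(ℝ, E)) x).linear ℝ hx).map_smul r ξ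
    simp only [h]
    exact (contDiff_id.smul contDiff_const).contMDiff.contMDiffAt
  exact (R.contMDiff'.comp hline).mdifferentiable (by simp)

variable [RiemannianBundle (fun x : M ↦ TangentSpace 𝓘(ℝ, E) x)]
  [IsContMDiffRiemannianBundle 𝓘(ℝ, E) ∞ E (fun x : M ↦ TangentSpace 𝓘(ℝ, E) x)]
  [FiniteDimensional ℝ E]
  {cov : CovariantDerivative 𝓘(ℝ, E) E (fun x : M ↦ TangentSpace 𝓘(ℝ, E) x)}

/-- In the frame fixed at `c t`, the inner product is a time-dependent bilinear form evaluated on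
two moving coordinate vectors. Metric compatibility turns the derivative of the form into the two
connection terms, and the parallel equations contribute the same terms with the opposite sign. -/
theorem IsParallelAlong.hasDerivWithinAt_inner (hcov : IsLeviCivita cov) {c : ℝ → M}
    {V W : (t : ℝ) → TangentSpace 𝓘(ℝ, E) (c t)}
    (hV : IsParallelAlong cov c V) (hW : IsParallelAlong cov c W) {t : ℝ} (ht : t ∈ Icc (0 : ℝ) 1)
    (hc : MDifferentiableAt 𝓘(ℝ, ℝ) 𝓘(ℝ, E) c t) :
    HasDerivWithinAt (fun r ↦ inner ℝ (V r) (W r)) 0 (Icc 0 1) t := by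
  set e := trivializationAt E (fun z : M ↦ TangentSpace 𝓘(ℝ, E) z) (c t) with he
  have hmem : c t ∈ e.baseSet := FiberBundle.mem_baseSet_trivializationAt' (c t)
  have hsymm : ∀ {y : M} (a : E), y ∈ e.baseSet → e.symmₗ ℝ y a = e.symm y a := fun a hy ↦
    e.symmₗ_apply hy a
  have hcoords : ∀ {y : M} (w : TangentSpace 𝓘(ℝ, E) y), y ∈ e.baseSet →
      e.symm y (coords (c t) w) = w := fun w hy ↦ Trivialization.symm_apply_apply_mk _ hy w
  let Bil : ℝ → E →ₗ[ℝ] E →ₗ[ℝ] ℝ := fun r ↦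
    (innerₗ (TangentSpace 𝓘(ℝ, E) (c r))).compl₁₂ (e.symmₗ ℝ (c r)) (e.symmₗ ℝ (c r))
  have hBil : ∀ {r} a b, c r ∈ e.baseSet → Bil r a b = inner ℝ (e.symm (c r) a) (e.symm (c r) b) := by
    intro r a b hr
    simp only [Bil, LinearMap.compl₁₂_apply, innerₗ_apply_apply, hsymm _ hr]
  have hnear : ∀ᶠ r in 𝓝[Icc 0 1] t, c r ∈ e.baseSet :=
    nhdsWithin_le_nhds (hc.continuousAt.eventually_mem (e.open_baseSet.mem_nhds hmem))
  -- Constant-coordinate fields are the extensions used to define parallelism, so the covariant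
  -- derivatives in the two places are literally the same.
  have hext : ∀ a : E, (fun y ↦ e.symm y a)
      = FiberBundle.extend E (e.symm (c t) a : TangentSpace 𝓘(ℝ, E) (c t)) := by
    intro a
    funext y
    simp only [FiberBundle.extend]
    rw [← he, Trivialization.apply_mk_symm _ hmem]
  have hmd : ∀ a : E, MDiffAt (T% (fun y ↦ e.symm y a)) (c t) := by
    intro a
    have h : (fun y ↦ (⟨y, e.symm y a⟩ : TangentBundle 𝓘(ℝ, E) M))
        = fun y ↦ ⟨y, FiberBundle.extend E (e.symm (c t) a : TangentSpace 𝓘(ℝ, E) (c t)) y⟩ :=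
      funext fun y ↦ congrArg _ (congrFun (hext a) y)
    rw [h]
    exact FiberBundle.mdifferentiableAt_extend ..
  let D : E → E → ℝ := fun a b ↦
    mvfderiv 𝓘(ℝ, E) (fun y ↦ inner ℝ (e.symm y a) (e.symm y b)) (c t) (velocity c t)
  have hD : ∀ a b, HasDerivWithinAt (fun r ↦ Bil r a b) (D a b) (Icc 0 1) t := by
    intro a b
    have h1 := MDifferentiableAt.inner_bundle (E := fun z : M ↦ TangentSpace 𝓘(ℝ, E) z) (hmd a) (hmd b)
    have h2 := mfderiv_comp_apply t h1 hc (1 : ℝ)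
    have h3 := (h1.comp t hc).differentiableAt.hasDerivAt.hasDerivWithinAt (s := Icc 0 1)
    rw [mfderiv_eq_fderiv] at h2
    refine (h3.congr_deriv ?_).congr_of_eventuallyEq_of_mem
      (hnear.mono fun r hr ↦ hBil a b hr) ht
    rw [← fderiv_apply_one_eq_deriv]
    exact h2
  have hunique : UniqueDiffWithinAt ℝ (Icc (0 : ℝ) 1) t :=
    uniqueDiffOn_Icc zero_lt_one t ht
  have key := hasDerivWithinAt_bilinear hunique hD (hV t ht) (hW t ht)
  have hval : D (coords (c t) (V t)) (coords (c t) (W t))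
      + Bil t (-coords (c t) (cov (FiberBundle.extend E (V t)) (c t) (velocity c t)))
        (coords (c t) (W t))
      + Bil t (coords (c t) (V t))
        (-coords (c t) (cov (FiberBundle.extend E (W t)) (c t) (velocity c t))) = 0 := by
    rw [hBil _ _ hmem, hBil _ _ hmem]
    have hneg : ∀ v : E, e.symm (c t) (-v) = -e.symm (c t) v := by
      intro v
      rw [← hsymm _ hmem, map_neg, hsymm _ hmem]
    rw [hneg, hneg, hcoords _ hmem, hcoords _ hmem, hcoords _ hmem,
      hcoords _ hmem]
    have h := hcov.metric (c t) (velocity c t) _ _ (hmd (coords (c t) (V t)))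
      (hmd (coords (c t) (W t)))
    simp only [D, h, hext, hcoords _ hmem, inner_neg_left,
      inner_neg_right]
    ring
  rw [hval] at key
  refine key.congr_of_eventuallyEq_of_mem ?_ ht
  filter_upwards [hnear] with r hr
  rw [hBil _ _ hr, hcoords _ hr, hcoords _ hr]

theorem IsParallelAlong.inner_eq (hcov : IsLeviCivita cov) {c : ℝ → M}
    {V W : (t : ℝ) → TangentSpace 𝓘(ℝ, E) (c t)}
    (hV : IsParallelAlong cov c V) (hW : IsParallelAlong cov c W)
    (hc : MDifferentiable 𝓘(ℝ, ℝ) 𝓘(ℝ, E) c) :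
    inner ℝ (V 1) (W 1) = inner ℝ (V 0) (W 0) := by
  have h := fun t (ht : t ∈ Icc (0 : ℝ) 1) ↦ hV.hasDerivWithinAt_inner hcov hW ht (hc t)
  exact constant_of_derivWithin_zero (f := fun r ↦ inner ℝ (V r) (W r))
    (fun t ht ↦ (h t ht).differentiableWithinAt)
    (fun t ht ↦ (h t (Ico_subset_Icc_self ht)).derivWithin
      (uniqueDiffOn_Icc zero_lt_one t (Ico_subset_Icc_self ht))) 1 (by simp)

theorem IsParallelTransport.norm_eq (hcov : IsLeviCivita cov) {c : ℝ → M}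
    {p q : TangentBundle 𝓘(ℝ, E) M} (h : IsParallelTransport cov c p q)
    (hc : MDifferentiable 𝓘(ℝ, ℝ) 𝓘(ℝ, E) c) : ‖p.2‖ = ‖q.2‖ := by
  obtain ⟨V, hV, rfl, rfl⟩ := h
  have h := hV.inner_eq hcov hV hc
  rw [real_inner_self_eq_norm_sq, real_inner_self_eq_norm_sq] at h
  exact ((sq_eq_sq₀ (norm_nonneg _) (norm_nonneg _)).1 h).symm

/-- No ODE uniqueness is needed: `‖V 1 - W 1‖²` expands into inner products of parallel fields, each
of which equals its value at time 0, where the fields agree. -/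
theorem IsParallelTransport.unique (hcov : IsLeviCivita cov) {c : ℝ → M}
    {p q q' : TangentBundle 𝓘(ℝ, E) M} (h : IsParallelTransport cov c p q)
    (h' : IsParallelTransport cov c p q') (hc : MDifferentiable 𝓘(ℝ, ℝ) 𝓘(ℝ, E) c) : q = q' := by
  obtain ⟨V, hV, rfl, rfl⟩ := h
  obtain ⟨W, hW, h0, rfl⟩ := h'
  have h0' : W 0 = V 0 := by simpa using h0
  have h1 : ‖V 1 - W 1‖ ^ 2 = 0 := by
    rw [norm_sub_sq_real, ← real_inner_self_eq_norm_sq, ← real_inner_self_eq_norm_sq,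
      hV.inner_eq hcov hV hc, hV.inner_eq hcov hW hc, hW.inner_eq hcov hW hc, h0']
    ring
  rw [sub_eq_zero.1 (norm_eq_zero.1 (pow_eq_zero_iff two_ne_zero |>.1 h1))]

end Geometry
-- Second moments under sampling with and without replacement.
section Sampling

theorem expect_prod {α β : Type*} [Fintype α] [Fintype β] (F : α × β → ℝ) :
    Finset.expect Finset.univ F = 𝔼 a, 𝔼 b, F (a, b) := by
  rw [← Finset.univ_product_univ, Finset.expect_product]

/-- Serves as conditioning: resampling one coordinate leaves the uniform law on the product
unchanged, so one can average over coordinate `i` with the others frozen. -/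
theorem expect_pi_update {ι α : Type*} [Fintype ι] [DecidableEq ι] [Fintype α] [Nonempty α]
    (i : ι) (F : (ι → α) → ℝ) :
    Finset.expect Finset.univ F = 𝔼 κ, 𝔼 a, F (Function.update κ i a) := by
  have h : ∀ G : (ι → α) → ℝ, Finset.expect Finset.univ G
      = 𝔼 a, 𝔼 r, G ((Equiv.funSplitAt i α).symm (a, r)) := by
    intro G
    rw [← expect_prod fun p ↦ G ((Equiv.funSplitAt i α).symm p)]
    exact Fintype.expect_equiv (Equiv.funSplitAt i α) _ _ fun κ ↦
      congrArg G ((Equiv.funSplitAt i α).symm_apply_apply κ).symm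
  rw [h, h]
  have hup : ∀ a r b, Function.update ((Equiv.funSplitAt i α).symm (a, r)) i b
      = (Equiv.funSplitAt i α).symm (b, r) := by
    intro a r b
    funext j
    by_cases hj : j = i
    · subst hj; simp
    · simp [hj]
  simp_rw [hup]
  rw [Fintype.expect_const, Finset.expect_comm]

theorem expect_fin_succ {α : Type*} [Fintype α] {b : ℕ} (F : (Fin (b + 1) → α) → ℝ) :
    Finset.expect Finset.univ F = 𝔼 a, 𝔼 l, F (Fin.cons a l) := by
  rw [← expect_prod fun p : α × (Fin b → α) ↦ F (Fin.cons p.1 p.2)]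
  exact Fintype.expect_equiv (Fin.consEquiv fun _ ↦ α).symm _ _ fun l ↦ by
    simp [Fin.consEquiv]

/-- Jensen's inequality for the square. -/
theorem sq_expect_le {α : Type*} [Fintype α] (F : α → ℝ) :
    (𝔼 a, F a) ^ 2 ≤ 𝔼 a, F a ^ 2 := by
  rw [Fintype.expect_eq_sum_div_card, Fintype.expect_eq_sum_div_card]
  rcases (Nat.cast_nonneg (Fintype.card α) : (0 : ℝ) ≤ _).eq_or_lt with h | h
  · simp [← h]
  · rw [div_pow, div_le_div_iff₀ (by positivity) h]
    have := sq_sum_le_card_mul_sum_sq (s := Finset.univ) (f := F)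
    rw [Finset.card_univ] at this
    nlinarith

theorem average_eq_expect {n : ℕ} (F : Fin n → ℝ) : (1 / (n : ℝ)) * ∑ i, F i = 𝔼 i, F i := by
  rw [Fintype.expect_eq_sum_div_card, Fintype.card_fin]
  ring

/-- Minkowski's inequality in `L²` with one constant summand: after expanding, Jensen bounds the
mean in the cross term by `A`. -/
theorem expect_add_sq_le {α : Type*} [Fintype α] [Nonempty α] {F : α → ℝ} {A d : ℝ}
    (hA : 0 ≤ A) (hd : 0 ≤ d) (hF : 𝔼 a, F a ^ 2 ≤ A ^ 2) :
    𝔼 a, (F a + d) ^ 2 ≤ (A + d) ^ 2 := by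
  have h1 : 𝔼 a, F a ≤ A := (abs_le_of_sq_le_sq' ((sq_expect_le F).trans hF) hA).2
  have h2 : 𝔼 a, (F a + d) ^ 2 = 𝔼 a, F a ^ 2 + 2 * d * 𝔼 a, F a + d ^ 2 := by
    rw [Finset.mul_expect]
    conv_rhs => rw [← Fintype.expect_const (ι := α) (d ^ 2)]
    rw [← Finset.expect_add_distrib, ← Finset.expect_add_distrib]
    exact Finset.expect_congr rfl fun a _ ↦ by ring
  rw [h2]
  nlinarith [mul_le_mul_of_nonneg_left h1 hd]

variable {H : Type*} [NormedAddCommGroup H] [InnerProductSpace ℝ H]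

theorem expect_norm_sq_add_of_sum_eq_zero {α : Type*} [Fintype α] [Nonempty α] {Z : α → H}
    (hZ : ∑ a, Z a = 0) (w : H) :
    𝔼 a, ‖Z a + w‖ ^ 2 = 𝔼 a, ‖Z a‖ ^ 2 + ‖w‖ ^ 2 := by
  have h : 𝔼 a, 2 * inner ℝ (Z a) w = 0 := by
    rw [Fintype.expect_eq_sum_div_card, ← Finset.mul_sum, ← sum_inner, hZ]
    simp
  simp_rw [norm_add_sq_real]
  rw [Finset.expect_add_distrib, Finset.expect_add_distrib, h, Fintype.expect_const, add_zero]

/-- Second moment of a sum of independent centred samples. -/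
theorem expect_norm_sq_sum_add {α : Type*} [Fintype α] [Nonempty α] {Z : α → H}
    (hZ : ∑ a, Z a = 0) (b : ℕ) (w : H) :
    𝔼 l : Fin b → α, ‖∑ j, Z (l j) + w‖ ^ 2 = b * 𝔼 a, ‖Z a‖ ^ 2 + ‖w‖ ^ 2 := by
  induction b generalizing w with
  | zero => simp
  | succ b ih =>
    rw [expect_fin_succ]
    -- The first sample is absorbed into the shift `w`, which is why the induction runs over all
    -- `w`.
    simp_rw [Fin.sum_univ_succ, Fin.cons_zero, Fin.cons_succ, add_comm (Z _) (∑ _, _), add_assoc,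
      ih]
    rw [Finset.expect_add_distrib, Fintype.expect_const, expect_norm_sq_add_of_sum_eq_zero hZ]
    push_cast
    ring

theorem expect_norm_sq_sub_average_le {n : ℕ} [NeZero n] (Y : Fin n → H) :
    𝔼 i, ‖Y i - (n : ℝ)⁻¹ • ∑ j, Y j‖ ^ 2 ≤ 𝔼 i, ‖Y i‖ ^ 2 := by
  have hZ : ∑ i, (Y i - (n : ℝ)⁻¹ • ∑ j, Y j) = 0 := by
    rw [Finset.sum_sub_distrib, Finset.sum_const, Finset.card_univ, Fintype.card_fin,
      ← Nat.cast_smul_eq_nsmul ℝ, smul_inv_smul₀ (NeZero.ne _), sub_self]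
  have h := expect_norm_sq_add_of_sum_eq_zero hZ ((n : ℝ)⁻¹ • ∑ j, Y j)
  simp only [sub_add_cancel] at h
  rw [h]
  exact le_add_of_nonneg_right (sq_nonneg _)

/-- Mean squared error of a mini-batch average drawn with replacement. -/
theorem expect_norm_sq_batch_le {n b : ℕ} [NeZero n] (hb : 0 < b) (Y : Fin n → H) (w : H) :
    𝔼 l : Fin b → Fin n, ‖(b : ℝ)⁻¹ • ∑ j, Y (l j) - (n : ℝ)⁻¹ • ∑ i, Y i + w‖ ^ 2
      ≤ ‖w‖ ^ 2 + (𝔼 i, ‖Y i‖ ^ 2) / b := by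
  have hb' : (b : ℝ) ≠ 0 := by positivity
  set Z : Fin n → H := fun i ↦ Y i - (n : ℝ)⁻¹ • ∑ j, Y j with hZdef
  have hZ : ∑ i, Z i = 0 := by
    rw [hZdef, Finset.sum_sub_distrib, Finset.sum_const, Finset.card_univ, Fintype.card_fin,
      ← Nat.cast_smul_eq_nsmul ℝ, smul_inv_smul₀ (NeZero.ne _), sub_self]
  have h : ∀ l : Fin b → Fin n, ‖(b : ℝ)⁻¹ • ∑ j, Y (l j) - (n : ℝ)⁻¹ • ∑ i, Y i + w‖ ^ 2
      = ((b : ℝ)⁻¹) ^ 2 * ‖∑ j, Z (l j) + (b : ℝ) • w‖ ^ 2 := by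
    intro l
    have : (b : ℝ)⁻¹ • ∑ j, Y (l j) - (n : ℝ)⁻¹ • ∑ i, Y i + w
        = (b : ℝ)⁻¹ • (∑ j, Z (l j) + (b : ℝ) • w) := by
      simp only [hZdef, Finset.sum_sub_distrib, Finset.sum_const, Finset.card_univ,
        Fintype.card_fin, ← Nat.cast_smul_eq_nsmul ℝ, smul_add, smul_sub]
      rw [inv_smul_smul₀ hb', inv_smul_smul₀ hb']
    rw [this, norm_smul, mul_pow]
    simp
  simp_rw [h]
  rw [← Finset.mul_expect, expect_norm_sq_sum_add hZ, norm_smul, mul_pow, Real.norm_eq_abs, sq_abs]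
  have hle := expect_norm_sq_sub_average_le Y
  calc ((b : ℝ)⁻¹) ^ 2 * (b * 𝔼 i, ‖Z i‖ ^ 2 + (b : ℝ) ^ 2 * ‖w‖ ^ 2)
      = ‖w‖ ^ 2 + (𝔼 i, ‖Z i‖ ^ 2) / b := by field_simp; ring
    _ ≤ _ := by gcongr

theorem card_subsets_containing {n B : ℕ} (s : Finset (Fin n)) (hs : s.card ≤ B) :
    (Finset.univ.filter fun A : {A : Finset (Fin n) // A.card = B} ↦ s ⊆ A.1).card
      = (n - s.card).choose (B - s.card) := by
  classical
  have h := Finset.card_filter_powersetCard_subset s Finset.univ B (Finset.subset_univ s) hs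
  rw [Finset.card_univ, Fintype.card_fin] at h
  rw [← h, ← Finset.card_map (Function.Embedding.subtype _)]
  congr 1
  ext A
  simp [and_comm]

/-- Mean squared error of a mini-batch average drawn without replacement. -/
theorem expect_norm_sq_subset_le {n B : ℕ} (hB : 0 < B) (hBn : B ≤ n) {Z : Fin n → H}
    (hZ : ∑ i, Z i = 0) :
    𝔼 A : {A : Finset (Fin n) // A.card = B}, ‖(B : ℝ)⁻¹ • ∑ i ∈ A.1, Z i‖ ^ 2
      ≤ if B < n then (𝔼 i, ‖Z i‖ ^ 2) / B else 0 := by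
  classical
  split_ifs with hlt
  swap
  · refine le_of_eq (Finset.expect_eq_zero fun A _ ↦ ?_)
    have : A.1 = Finset.univ := Finset.card_eq_iff_eq_univ _ |>.1 (by
      rw [A.2, Fintype.card_fin]; omega)
    rw [this, hZ]
    simp
  -- `N₁` and `N₂` count the `B`-subsets containing a given index and a given pair. For `B = 1` the
  -- truncated binomial would be 1 rather than 0, hence the case distinction in `N₂`.
  set N₁ : ℝ := (((n - 1).choose (B - 1) : ℕ) : ℝ) with hN₁
  set N₂ : ℝ := if 2 ≤ B then (((n - 2).choose (B - 2) : ℕ) : ℝ) else 0 with hN₂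
  have hN₂0 : 0 ≤ N₂ := by rw [hN₂]; split_ifs <;> positivity
  have hcount : ∀ i j, (∑ A : {A : Finset (Fin n) // A.card = B},
      if i ∈ A.1 ∧ j ∈ A.1 then (1 : ℝ) else 0) = if i = j then N₁ else N₂ := by
    intro i j
    have hpair : ∀ A : Finset (Fin n), (i ∈ A ∧ j ∈ A) ↔ ({i, j} : Finset (Fin n)) ⊆ A := by
      intro A
      simp [Finset.insert_subset_iff]
    simp_rw [hpair]
    rw [Finset.sum_boole]
    split_ifs with hij
    · subst hij
      rw [card_subsets_containing _ (by simpa using Nat.succ_le_of_lt hB), Finset.pair_eq_singleton,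
        Finset.card_singleton]
    · rw [hN₂]
      split_ifs with hB2
      · rw [card_subsets_containing _ (by rw [Finset.card_pair hij]; exact hB2),
          Finset.card_pair hij]
      · rw [Nat.cast_eq_zero, Finset.card_eq_zero, Finset.filter_eq_empty_iff]
        intro A _ hA
        have := Finset.card_le_card hA
        rw [Finset.card_pair hij, A.2] at this
        exact hB2 this
  have hsum : ∑ A : {A : Finset (Fin n) // A.card = B}, ‖∑ i ∈ A.1, Z i‖ ^ 2
      = (N₁ - N₂) * ∑ i, ‖Z i‖ ^ 2 := by
    have h1 : ∀ A : {A : Finset (Fin n) // A.card = B}, ‖∑ i ∈ A.1, Z i‖ ^ 2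
        = ∑ i, ∑ j, (if i ∈ A.1 ∧ j ∈ A.1 then (1 : ℝ) else 0) * inner ℝ (Z i) (Z j) := by
      intro A
      have h2 : ∑ i ∈ A.1, Z i = ∑ i, if i ∈ A.1 then Z i else 0 := by simp
      rw [← real_inner_self_eq_norm_sq, h2, sum_inner]
      simp_rw [inner_sum]
      refine Finset.sum_congr rfl fun i _ ↦ Finset.sum_congr rfl fun j _ ↦ ?_
      by_cases hi : i ∈ A.1 <;> by_cases hj : j ∈ A.1 <;> simp [hi, hj]
    simp_rw [h1]
    rw [Finset.sum_comm]
    simp_rw [fun i ↦ Finset.sum_comm (s := (Finset.univ : Finset {A : Finset (Fin n) // A.card = B}))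
      (t := Finset.univ) (f := fun A j ↦ (if i ∈ A.1 ∧ j ∈ A.1 then (1 : ℝ) else 0)
        * inner ℝ (Z i) (Z j)), ← Finset.sum_mul, hcount]
    -- The part with constant weight `N₂` is `N₂ ‖∑ Z i‖² = 0`, so only the diagonal with weight `N₁
    -- - N₂` remains.
    have h2 : ∀ i j, (if i = j then N₁ else N₂) * inner ℝ (Z i) (Z j)
        = N₂ * inner ℝ (Z i) (Z j) + if i = j then (N₁ - N₂) * inner ℝ (Z i) (Z j) else 0 := by
      intro i j
      split_ifs <;> ring
    simp_rw [h2, Finset.sum_add_distrib, ← Finset.mul_sum, ← inner_sum, hZ, inner_zero_right]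
    simp [Finset.mul_sum]
  have hchoose : (n : ℝ) * N₁ = ((n.choose B : ℕ) : ℝ) * B := by
    obtain ⟨n, rfl⟩ : ∃ k, n = k + 1 := ⟨n - 1, by omega⟩
    obtain ⟨B, rfl⟩ : ∃ k, B = k + 1 := ⟨B - 1, by omega⟩
    simpa [hN₁] using congrArg (Nat.cast (R := ℝ)) (Nat.add_one_mul_choose_eq n B)
  have hcard : Fintype.card {A : Finset (Fin n) // A.card = B} = n.choose B := by
    simp
  have hpos : (0 : ℝ) < ((n.choose B : ℕ) : ℝ) := by exact_mod_cast Nat.choose_pos hBn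
  have hnpos : (0 : ℝ) < n := by exact_mod_cast hB.trans_le hBn
  have hBpos : (0 : ℝ) < B := by exact_mod_cast hB
  simp_rw [norm_smul, mul_pow]
  rw [← Finset.mul_expect, Fintype.expect_eq_sum_div_card, hsum, hcard,
    Fintype.expect_eq_sum_div_card, Fintype.card_fin, norm_inv, Real.norm_eq_abs, inv_pow, sq_abs]
  have hS : 0 ≤ ∑ i, ‖Z i‖ ^ 2 := Finset.sum_nonneg fun i _ ↦ sq_nonneg _
  have hN₁' : N₁ = ((n.choose B : ℕ) : ℝ) * B / n := by field_simp; linarith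
  -- Dropping `N₂ ≥ 0` gives up the finite-population gain and leaves the with-replacement bound.
  calc ((B : ℝ) ^ 2)⁻¹ * (((N₁ - N₂) * ∑ i, ‖Z i‖ ^ 2) / ((n.choose B : ℕ) : ℝ))
      ≤ ((B : ℝ) ^ 2)⁻¹ * ((N₁ * ∑ i, ‖Z i‖ ^ 2) / ((n.choose B : ℕ) : ℝ)) := by
        gcongr
        linarith
    _ = (∑ i, ‖Z i‖ ^ 2) / n / B := by
        rw [hN₁']
        field_simp

end Sampling
-- Linearity of the gradient; closed forms for mini-batch gradients and their cost.
section Gradients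

variable {E : Type u} [NormedAddCommGroup E] [NormedSpace ℝ E]
  {M : Type v} [TopologicalSpace M] [ChartedSpace E M] [IsManifold 𝓘(ℝ, E) ∞ M]
  [RiemannianBundle (fun x : M ↦ TangentSpace 𝓘(ℝ, E) x)] [FiniteDimensional ℝ E]
  {n : ℕ} {f : Fin n → M → ℝ}

theorem mvfderiv_sum {ι : Type*} (s : Finset ι) (g : ι → M → ℝ) {x : M}
    (hg : ∀ i, MDifferentiableAt 𝓘(ℝ, E) 𝓘(ℝ, ℝ) (g i) x) :
    MDifferentiableAt 𝓘(ℝ, E) 𝓘(ℝ, ℝ) (fun y ↦ ∑ i ∈ s, g i y) x ∧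
      ∀ w, mvfderiv 𝓘(ℝ, E) (fun y ↦ ∑ i ∈ s, g i y) x w = ∑ i ∈ s, mvfderiv 𝓘(ℝ, E) (g i) x w := by
  classical
  induction s using Finset.induction_on with
  | empty =>
    refine ⟨by simpa using mdifferentiableAt_const, fun w ↦ ?_⟩
    simp [mvfderiv_const]
  | insert a s ha ih =>
    simp_rw [Finset.sum_insert ha]
    refine ⟨(hg a).add ih.1, fun w ↦ ?_⟩
    rw [mvfderiv_fun_add (hg a) ih.1, add_apply, ih.2]

theorem grad_avg {x : M} (hf : ∀ i, MDifferentiableAt 𝓘(ℝ, E) 𝓘(ℝ, ℝ) (f i) x) :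
    grad (E := E) (avg f) x = (n : ℝ)⁻¹ • ∑ i, grad (f i) x := by
  obtain ⟨hsum, hval⟩ := mvfderiv_sum Finset.univ f hf
  refine ext_inner_right ℝ fun w ↦ ?_
  have hconst : MDifferentiableAt 𝓘(ℝ, E) 𝓘(ℝ, ℝ) (fun _ : M ↦ 1 / (n : ℝ)) x :=
    mdifferentiableAt_const
  have h : mvfderiv 𝓘(ℝ, E) (avg f) x w
      = 1 / (n : ℝ) * mvfderiv 𝓘(ℝ, E) (fun y ↦ ∑ i, f i y) x w := by
    unfold avg
    rw [mvfderiv_fun_mul hconst hsum]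
    simp [mvfderiv_const]
  rw [inner_grad, h, hval, inner_smul_left, sum_inner]
  simp [inner_grad]

theorem query_eq (f : Fin n → M → ℝ) (x : M) (l : List (Fin n)) :
    query (E := E) f x l = ((l.map fun i ↦ grad (E := E) (f i) x).sum, l.length) := by
  induction l with
  | nil => rfl
  | cons i l ih => simp [query, ih]

theorem batchGrad_fst (f : Fin n → M → ℝ) (x : M) (l : List (Fin n)) :
    (batchGrad (E := E) f x l).1
      = (l.length : ℝ)⁻¹ • (l.map fun i ↦ grad (E := E) (f i) x).sum := by
  rw [batchGrad, query_eq]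

theorem batchGrad_snd (f : Fin n → M → ℝ) (x : M) (l : List (Fin n)) :
    (batchGrad (E := E) f x l).2 = l.length := by
  rw [batchGrad, query_eq]

theorem batchGrad_ofFn {b : ℕ} (f : Fin n → M → ℝ) (x : M) (l : Fin b → Fin n) :
    (batchGrad (E := E) f x (List.ofFn l)).1 = (b : ℝ)⁻¹ • ∑ j, grad (E := E) (f (l j)) x := by
  rw [batchGrad_fst, List.length_ofFn, List.map_ofFn, List.sum_ofFn]
  rfl

theorem batchGrad_toList (f : Fin n → M → ℝ) (x : M) (A : Finset (Fin n)) :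
    (batchGrad (E := E) f x A.toList).1 = (A.card : ℝ)⁻¹ • ∑ i ∈ A, grad (E := E) (f i) x := by
  rw [batchGrad_fst, Finset.length_toList, Finset.sum_map_toList]

end Gradients

/-! ### Estimates for a single iteration. -/

section Steps

variable {E : Type u} [NormedAddCommGroup E] [NormedSpace ℝ E]
  {M : Type v} [TopologicalSpace M] [ChartedSpace E M] [IsManifold 𝓘(ℝ, E) ∞ M]
  [RiemannianBundle (fun x : M ↦ TangentSpace 𝓘(ℝ, E) x)] [FiniteDimensional ℝ E]
  {cov : CovariantDerivative 𝓘(ℝ, E) E (fun x : M ↦ TangentSpace 𝓘(ℝ, E) x)}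
  {n : ℕ} {f : Fin n → M → ℝ} {R : Retraction E M} {T : VectorTransport R}
  {X : Set M} {xs : M} {L Ll θ G σ η : ℝ}

theorem Assumptions.mdifferentiableAt (hA : Assumptions cov f R T X xs L Ll θ G σ) (x : M)
    (i : Fin n) : MDifferentiableAt 𝓘(ℝ, E) 𝓘(ℝ, ℝ) (f i) x :=
  ((hA.contMDiff i).mdifferentiable (by simp)) x

/-- Splits `grad f_i(x)` as `(grad f_i(x) - u i) + u i`. On the first part `T` is isometric and the
`Ll` bound applies in mean square. The parallel transport of `u i` is exactly the gradient at the
endpoint, so `T (u i)` misses it by at most `θ ‖ξ‖ G`, since `‖u i‖ ≤ G` by norm preservation. -/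
theorem Assumptions.expect_norm_sq_sub_transport_le
    [IsContMDiffRiemannianBundle 𝓘(ℝ, E) ∞ E (fun x : M ↦ TangentSpace 𝓘(ℝ, E) x)] [NeZero n]
    (hcov : IsLeviCivita cov) (hA : Assumptions cov f R T X xs L Ll θ G σ)
    (hLl : 0 ≤ Ll) (hθ : 0 ≤ θ) (hG : 0 ≤ G)
    {x : M} {ξ : TangentSpace 𝓘(ℝ, E) x} (hseg : R.SegmentIn X x ξ) :
    𝔼 i, ‖grad (E := E) (f i) (R.toFun x ξ) - T.toFun x ξ (grad (E := E) (f i) x)‖ ^ 2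
      ≤ ((Ll + θ * G) * ‖ξ‖) ^ 2 := by
  obtain ⟨u, hu, hsq⟩ := hA.lipschitz x ξ hseg
  rw [average_eq_expect] at hsq
  have hc := R.mdifferentiable_curve x ξ
  have hnorm : ∀ i, ‖u i‖ ≤ G := fun i ↦
    ((hu i).norm_eq hcov hc).trans_le (hA.grad_le i _ hseg.right_mem)
  have htrans : ∀ i, ‖T.toFun x ξ (u i) - grad (E := E) (f i) (R.toFun x ξ)‖ ≤ θ * ‖ξ‖ * G := by
    intro i
    obtain ⟨w, hw, hle⟩ := hA.transport x ξ hseg (u i)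
    have : w = grad (f i) (R.toFun x ξ) := by simpa using hw.unique hcov (hu i) hc
    subst this
    exact hle.trans (mul_le_mul_of_nonneg_left (hnorm i) (by positivity))
  have hterm : ∀ i, ‖grad (E := E) (f i) (R.toFun x ξ) - T.toFun x ξ (grad (E := E) (f i) x)‖
      ≤ ‖grad (E := E) (f i) x - u i‖ + θ * ‖ξ‖ * G := by
    intro i
    have h : grad (E := E) (f i) (R.toFun x ξ) - T.toFun x ξ (grad (E := E) (f i) x)
        = -(T.toFun x ξ (grad (E := E) (f i) x - u i)
          + (T.toFun x ξ (u i) - grad (E := E) (f i) (R.toFun x ξ))) := by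
      rw [map_sub]
      abel
    rw [h, norm_neg]
    exact (norm_add_le _ _).trans (add_le_add ((T.toFun x ξ).norm_map _).le (htrans i))
  calc _ ≤ 𝔼 i, (‖grad (E := E) (f i) x - u i‖ + θ * ‖ξ‖ * G) ^ 2 :=
        Finset.expect_le_expect fun i _ ↦ pow_le_pow_left₀ (norm_nonneg _) (hterm i) 2
    _ ≤ (Ll * ‖ξ‖ + θ * ‖ξ‖ * G) ^ 2 :=
        expect_add_sq_le (by positivity) (by positivity) hsq
    _ = _ := by ring

/-- The squared error of the modified gradient. -/
noncomputable def State.error (f : Fin n → M → ℝ) (p : State E M) : ℝ :=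
  ‖p.dir - grad (avg f) p.point‖ ^ 2

theorem State.norm_step (p : State E M) (hη : 0 ≤ η) : ‖p.step η‖ = η * ‖p.dir‖ := by
  rw [State.step, norm_neg, norm_smul, Real.norm_of_nonneg hη]

/-- The new error vector is a centred mini-batch mean of the differences `Y i` plus the transported
old error. The means are uncorrelated with the fixed second term, whose norm the isometry leaves
unchanged. -/
theorem Assumptions.expect_error_innerStep_le
    [IsContMDiffRiemannianBundle 𝓘(ℝ, E) ∞ E (fun x : M ↦ TangentSpace 𝓘(ℝ, E) x)] [NeZero n]
    (hcov : IsLeviCivita cov) (hA : Assumptions cov f R T X xs L Ll θ G σ)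
    (hLl : 0 ≤ Ll) (hθ : 0 ≤ θ) (hG : 0 ≤ G) (hη : 0 ≤ η) {b : ℕ} (hb : 0 < b)
    {p : State E M} (hseg : R.SegmentIn X p.point (p.step η)) :
    𝔼 l : Fin b → Fin n, (innerStep f R T η p (List.ofFn l)).error f
      ≤ p.error f + (Ll + θ * G) ^ 2 * η ^ 2 / b * ‖p.dir‖ ^ 2 := by
  set y := R.toFun p.point (p.step η) with hy
  set τ := T.toFun p.point (p.step η) with hτ
  let Y : Fin n → TangentSpace 𝓘(ℝ, E) y := fun i ↦
    grad (E := E) (f i) y - τ (grad (E := E) (f i) p.point)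
  have hY : (n : ℝ)⁻¹ • ∑ i, Y i
      = grad (E := E) (avg f) y - τ (grad (E := E) (avg f) p.point) := by
    rw [grad_avg (hA.mdifferentiableAt y), grad_avg (hA.mdifferentiableAt p.point), map_smul,
      map_sum, ← smul_sub, ← Finset.sum_sub_distrib]
  have h : ∀ l : Fin b → Fin n, (innerStep f R T η p (List.ofFn l)).error f
      = ‖(b : ℝ)⁻¹ • ∑ j, Y (l j) - (n : ℝ)⁻¹ • ∑ i, Y i
        + τ (p.dir - grad (E := E) (avg f) p.point)‖ ^ 2 := by
    intro l
    have : (innerStep f R T η p (List.ofFn l)).error f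
        = ‖((batchGrad f y (List.ofFn l)).1
          - τ ((batchGrad f p.point (List.ofFn l)).1 - p.dir)) - grad (E := E) (avg f) y‖ ^ 2 := rfl
    rw [this, batchGrad_ofFn, batchGrad_ofFn, hY]
    simp only [Y, map_sub, map_smul, map_sum, Finset.sum_sub_distrib, smul_sub]
    congr 2
    abel
  simp_rw [h]
  refine (expect_norm_sq_batch_le hb Y _).trans ?_
  rw [τ.norm_map]
  have hb' : (0 : ℝ) < b := by exact_mod_cast hb
  have hle := hA.expect_norm_sq_sub_transport_le hcov hLl hθ hG hseg
  rw [p.norm_step hη] at hle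
  have : (𝔼 i, ‖Y i‖ ^ 2) / b ≤ (Ll + θ * G) ^ 2 * η ^ 2 / b * ‖p.dir‖ ^ 2 := by
    rw [div_mul_eq_mul_div]
    exact div_le_div_of_nonneg_right (hle.trans_eq (by ring)) hb'.le
  exact add_le_add_right this _

/-- Polarization: `-2⟨g, v⟩ = ‖v - g‖² - ‖v‖² - ‖g‖²` in the smoothness inequality. -/
theorem Assumptions.avg_step_le (hA : Assumptions cov f R T X xs L Ll θ G σ) (hη : 0 ≤ η)
    {p : State E M} (hseg : R.SegmentIn X p.point (p.step η)) :
    η / 2 * ‖grad (E := E) (avg f) p.point‖ ^ 2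
      ≤ avg f p.point - avg f (R.toFun p.point (p.step η))
        + η / 2 * p.error f - (η / 2 - L * η ^ 2 / 2) * ‖p.dir‖ ^ 2 := by
  have h := hA.smooth p.point (p.step η) hseg
  rw [p.norm_step hη] at h
  have h1 : p.error f = ‖p.dir‖ ^ 2 - 2 * inner ℝ (grad (E := E) (avg f) p.point) p.dir
      + ‖grad (E := E) (avg f) p.point‖ ^ 2 := by
    rw [State.error, norm_sub_sq_real, real_inner_comm]
  have h2 : inner ℝ (grad (E := E) (avg f) p.point) (p.step η)
      = -(η * inner ℝ (grad (E := E) (avg f) p.point) p.dir) := by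
    rw [State.step, inner_neg_right, inner_smul_right]
  rw [h2] at h
  rw [h1]
  nlinarith

theorem Assumptions.expect_error_batch_le [NeZero n]
    (hA : Assumptions cov f R T X xs L Ll θ G σ) {B : ℕ} (hB : 0 < B) (hBn : B ≤ n)
    {x : M} (hx : x ∈ X) :
    𝔼 A : {A : Finset (Fin n) // A.card = B},
        ‖(batchGrad (E := E) f x A.1.toList).1 - grad (E := E) (avg f) x‖ ^ 2
      ≤ if B < n then σ ^ 2 / B else 0 := by
  have hB' : (B : ℝ) ≠ 0 := by positivity
  let Z : Fin n → TangentSpace 𝓘(ℝ, E) x := fun i ↦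
    grad (E := E) (f i) x - grad (E := E) (avg f) x
  have hZ : ∑ i, Z i = 0 := by
    simp only [Z, Finset.sum_sub_distrib, Finset.sum_const, Finset.card_univ, Fintype.card_fin]
    rw [grad_avg (hA.mdifferentiableAt x), ← Nat.cast_smul_eq_nsmul ℝ,
      smul_inv_smul₀ (NeZero.ne _), sub_self]
  have h : ∀ A : {A : Finset (Fin n) // A.card = B},
      (batchGrad (E := E) f x A.1.toList).1 - grad (E := E) (avg f) x
        = (B : ℝ)⁻¹ • ∑ i ∈ A.1, Z i := by
    intro A
    rw [batchGrad_toList, Finset.sum_sub_distrib, Finset.sum_const, A.2, smul_sub,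
      ← Nat.cast_smul_eq_nsmul ℝ, inv_smul_smul₀ hB']
  simp_rw [h]
  refine (expect_norm_sq_subset_le hB hBn hZ).trans ?_
  have hvar := hA.variance_le x hx
  rw [average_eq_expect] at hvar
  split_ifs
  · exact div_le_div_of_nonneg_right hvar (Nat.cast_nonneg B)
  · exact le_rfl

end Steps
-- Summing over one epoch.
/-- Summation of the descent inequalities of one epoch: `g`, `F`, `F'`, `e`, `d` are the expected
squared gradient norm, objective value, next objective value, squared error and squared step. -/
theorem sum_range_sq_grad_le {m : ℕ} (hm : 0 < m) {η L a V : ℝ} (hη : 0 < η) (ha : 0 ≤ a)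
    {g F F' e d : ℕ → ℝ} (hd : ∀ t, 0 ≤ d t)
    (hdescent : ∀ t < m,
      η / 2 * g t ≤ F t - F' t + η / 2 * e t - (η / 2 - L * η ^ 2 / 2) * d t)
    (hnext : ∀ t, t + 1 < m → F (t + 1) = F' t)
    (he0 : e 0 ≤ V) (he : ∀ t, t + 1 < m → e (t + 1) ≤ e t + a * d t)
    (hsmall : a * m + L * η ≤ 1) :
    ∑ t ∈ Finset.range m, g t ≤ 2 / η * (F 0 - F' (m - 1)) + m * V := by
  have herr : ∀ t < m, e t ≤ V + a * ∑ j ∈ Finset.range m, d j := by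
    have haux : ∀ t < m, e t ≤ V + a * ∑ j ∈ Finset.range t, d j := by
      intro t
      induction t with
      | zero => intro _; simpa using he0
      | succ t ih =>
        intro ht
        rw [Finset.sum_range_succ, mul_add]
        linarith [he t ht, ih (by omega)]
    intro t ht
    refine (haux t ht).trans (add_le_add_right (mul_le_mul_of_nonneg_left ?_ ha) _)
    exact Finset.sum_le_sum_of_subset_of_nonneg (Finset.range_mono ht.le) fun j _ _ ↦ hd j
  have htel : ∑ t ∈ Finset.range m, (F t - F' t) = F 0 - F' (m - 1) := by
    have haux : ∀ k < m, ∑ t ∈ Finset.range (k + 1), (F t - F' t) = F 0 - F' k := by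
      intro k
      induction k with
      | zero => intro _; simp
      | succ k ih =>
        intro hk
        rw [Finset.sum_range_succ, ih (by omega), hnext k hk]
        ring
    simpa [Nat.sub_add_cancel hm] using haux (m - 1) (by omega)
  set D := ∑ j ∈ Finset.range m, d j with hD
  have hDnn : 0 ≤ D := Finset.sum_nonneg fun j _ ↦ hd j
  have hsum : η / 2 * ∑ t ∈ Finset.range m, g t
      ≤ (F 0 - F' (m - 1)) + η / 2 * (m * (V + a * D)) - (η / 2 - L * η ^ 2 / 2) * D := by
    calc η / 2 * ∑ t ∈ Finset.range m, g t
        = ∑ t ∈ Finset.range m, η / 2 * g t := Finset.mul_sum ..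
      _ ≤ ∑ t ∈ Finset.range m,
          ((F t - F' t) + η / 2 * (V + a * D) - (η / 2 - L * η ^ 2 / 2) * d t) := by
          refine Finset.sum_le_sum fun t ht ↦ ?_
          have ht' := Finset.mem_range.1 ht
          have := mul_le_mul_of_nonneg_left (herr t ht') (by positivity : 0 ≤ η / 2)
          linarith [hdescent t ht']
      _ = _ := by
          rw [Finset.sum_sub_distrib, Finset.sum_add_distrib, htel, Finset.sum_const,
            Finset.card_range, nsmul_eq_mul, ← Finset.mul_sum, ← hD]
          ring
  -- The total coefficient of `D` is `η/2 (a m + L η - 1)`, nonpositive by `hsmall`.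
  have hfin : η / 2 * ∑ t ∈ Finset.range m, g t ≤ (F 0 - F' (m - 1)) + η / 2 * (m * V) := by
    nlinarith [mul_nonneg (mul_nonneg hη.le hDnn) (sub_nonneg.2 hsmall)]
  have h2 : 2 / η * (η / 2 * ∑ t ∈ Finset.range m, g t)
      ≤ 2 / η * ((F 0 - F' (m - 1)) + η / 2 * (m * V)) :=
    mul_le_mul_of_nonneg_left hfin (by positivity)
  calc _ = 2 / η * (η / 2 * ∑ t ∈ Finset.range m, g t) := by field_simp
    _ ≤ _ := h2
    _ = _ := by field_simp

/-! ### Dependence on past samples, oracle counts, and the convergence bound. -/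

section Runs

variable {E : Type u} [NormedAddCommGroup E] [NormedSpace ℝ E]
  {M : Type v} [TopologicalSpace M] [ChartedSpace E M] [IsManifold 𝓘(ℝ, E) ∞ M]
  [RiemannianBundle (fun x : M ↦ TangentSpace 𝓘(ℝ, E) x)] [FiniteDimensional ℝ E]
  {cov : CovariantDerivative 𝓘(ℝ, E) E (fun x : M ↦ TangentSpace 𝓘(ℝ, E) x)}
  {n : ℕ} {f : Fin n → M → ℝ} {R : Retraction E M} {T : VectorTransport R}
  {X : Set M} {xs : M} {L Ll θ G σ η : ℝ} {B m b S : ℕ}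

theorem epochState_succ (x : M) (k : ℕ) (κ : EpochSample n B m b) {t : ℕ} (ht : t < m - 1) :
    epochState f R T η x k κ (t + 1)
      = innerStep f R T η (epochState f R T η x k κ t) (List.ofFn (κ.2 ⟨t, ht⟩)) :=
  dif_pos ht

theorem snapshot_succ (x₀ : M) (κ : Fin S → EpochSample n B m b) {s : ℕ} (hs : s < S) :
    snapshot f R T η x₀ κ (s + 1)
      = (R.toFun (epochState f R T η (snapshot f R T η x₀ κ s).1 (snapshot f R T η x₀ κ s).2
            (κ ⟨s, hs⟩) (m - 1)).point
          ((epochState f R T η (snapshot f R T η x₀ κ s).1 (snapshot f R T η x₀ κ s).2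
            (κ ⟨s, hs⟩) (m - 1)).step η),
        (epochState f R T η (snapshot f R T η x₀ κ s).1 (snapshot f R T η x₀ κ s).2
          (κ ⟨s, hs⟩) (m - 1)).calls) :=
  dif_pos hs

/-- The state at time `t` of an epoch only depends on the samples drawn before time `t`. -/
theorem epochState_update (x : M) (k : ℕ) (A : {A : Finset (Fin n) // A.card = B})
    (J : Fin (m - 1) → Fin b → Fin n) (i : Fin (m - 1)) (l : Fin b → Fin n) {t : ℕ}
    (ht : t ≤ i) :
    epochState f R T η x k (A, Function.update J i l) t = epochState f R T η x k (A, J) t := by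
  induction t with
  | zero => rfl
  | succ t ih =>
    have ht' : t < m - 1 := by omega
    have hne : (⟨t, ht'⟩ : Fin (m - 1)) ≠ i := Fin.ne_of_val_ne (by simp; omega)
    rw [epochState_succ _ _ _ ht', epochState_succ _ _ _ ht', ih (by omega)]
    simp only [Function.update_of_ne hne]

/-- A snapshot only depends on the samples of the earlier epochs. -/
theorem snapshot_update (x₀ : M) (κ : Fin S → EpochSample n B m b) (i : Fin S)
    (a : EpochSample n B m b) {s : ℕ} (hs : s ≤ i) :
    snapshot f R T η x₀ (Function.update κ i a) s = snapshot f R T η x₀ κ s := by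
  induction s with
  | zero => rfl
  | succ s ih =>
    have hs' : s < S := by omega
    have hne : (⟨s, hs'⟩ : Fin S) ≠ i := Fin.ne_of_val_ne (by simp; omega)
    rw [snapshot_succ _ _ hs', snapshot_succ _ _ hs', ih (by omega), Function.update_of_ne hne]

theorem epochState_calls (x : M) (k : ℕ) (κ : EpochSample n B m b) {t : ℕ} (ht : t ≤ m - 1) :
    (epochState f R T η x k κ t).calls = k + B + t * (2 * b) := by
  induction t with
  | zero =>
    simp [epochState, batchGrad_snd, κ.1.2]
  | succ t ih =>
    rw [epochState_succ _ _ _ (by omega : t < m - 1)]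
    simp only [innerStep, batchGrad_snd, List.length_ofFn]
    rw [ih (by omega)]
    ring

theorem snapshot_calls (x₀ : M) (κ : Fin S → EpochSample n B m b) {s : ℕ} (hs : s ≤ S) :
    (snapshot f R T η x₀ κ s).2 = s * (B + (m - 1) * (2 * b)) := by
  induction s with
  | zero => simp [snapshot]
  | succ s ih =>
    rw [snapshot_succ _ _ (by omega : s < S)]
    simp only
    rw [epochState_calls _ _ _ le_rfl, ih (by omega)]
    ring

theorem Assumptions.expect_epoch_le
    [IsContMDiffRiemannianBundle 𝓘(ℝ, E) ∞ E (fun x : M ↦ TangentSpace 𝓘(ℝ, E) x)] [NeZero n]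
    (hcov : IsLeviCivita cov) (hA : Assumptions cov f R T X xs L Ll θ G σ)
    (hLl : 0 ≤ Ll) (hθ : 0 ≤ θ) (hG : 0 ≤ G) (hη : 0 < η)
    (hm : 0 < m) (hb : 0 < b) (hB : 0 < B) (hBn : B ≤ n) [Nonempty (EpochSample n B m b)]
    (hsmall : (Ll + θ * G) ^ 2 * η ^ 2 / b * m + L * η ≤ 1) {x : M} {k : ℕ}
    (hseg : ∀ (κ : EpochSample n B m b) (t : ℕ), t < m →
      R.SegmentIn X (epochState f R T η x k κ t).point ((epochState f R T η x k κ t).step η)) :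
    𝔼 κ : EpochSample n B m b, ∑ t : Fin m,
        ‖grad (E := E) (avg f) (epochState f R T η x k κ t).point‖ ^ 2
      ≤ 2 / η * (avg f x - 𝔼 κ : EpochSample n B m b,
          avg f (R.toFun (epochState f R T η x k κ (m - 1)).point
            ((epochState f R T η x k κ (m - 1)).step η)))
        + m * (if B < n then σ ^ 2 / B else 0) := by
  have κ₀ : EpochSample n B m b := Classical.arbitrary _
  have : Nonempty {A : Finset (Fin n) // A.card = B} := ⟨κ₀.1⟩
  have hx : x ∈ X := (hseg κ₀ 0 hm).left_mem
  let p : ℕ → EpochSample n B m b → State E M := fun t κ ↦ epochState f R T η x k κ t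
  have hF0 : 𝔼 κ, avg f (p 0 κ).point = avg f x :=
    Fintype.expect_const (ι := EpochSample n B m b) (avg f x)
  rw [Finset.expect_sum_comm, Fin.sum_univ_eq_sum_range
    fun t ↦ 𝔼 κ, ‖grad (E := E) (avg f) (p t κ).point‖ ^ 2, ← hF0]
  -- `F'` is kept apart from the shifted `F` because `epochState` freezes at time `m - 1`: the point
  -- `x_m` appears only as the endpoint of the last move.
  refine sum_range_sq_grad_le (F := fun t ↦ 𝔼 κ, avg f (p t κ).point)
    (F' := fun t ↦ 𝔼 κ, avg f (R.toFun (p t κ).point ((p t κ).step η)))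
    (e := fun t ↦ 𝔼 κ, (p t κ).error f) (d := fun t ↦ 𝔼 κ, ‖(p t κ).dir‖ ^ 2)
    (L := L) (a := (Ll + θ * G) ^ 2 * η ^ 2 / b) hm hη (by positivity)
    (fun t ↦ Finset.expect_nonneg fun κ _ ↦ sq_nonneg _) ?_ ?_ ?_ ?_ hsmall
  · intro t ht
    simp only [Finset.mul_expect, ← Finset.expect_sub_distrib, ← Finset.expect_add_distrib]
    exact Finset.expect_le_expect fun κ _ ↦ hA.avg_step_le hη.le (hseg κ t ht)
  · intro t ht
    refine Finset.expect_congr rfl fun κ _ ↦ ?_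
    simp only [p]
    rw [epochState_succ _ _ _ (by omega : t < m - 1)]
    rfl
  · rw [expect_prod]
    have h : ∀ (A : {A : Finset (Fin n) // A.card = B}) (J : Fin (m - 1) → Fin b → Fin n),
        (p 0 (A, J)).error f
          = ‖(batchGrad (E := E) f x A.1.toList).1 - grad (E := E) (avg f) x‖ ^ 2 := fun A J ↦ rfl
    simp_rw [h, Fintype.expect_const]
    exact hA.expect_error_batch_le hB hBn hx
  · intro t ht
    have ht' : t < m - 1 := by omega
    rw [expect_prod, expect_prod fun κ ↦ ‖(p t κ).dir‖ ^ 2, expect_prod fun κ ↦ (p t κ).error f,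
      Finset.mul_expect, ← Finset.expect_add_distrib]
    refine Finset.expect_le_expect fun A _ ↦ ?_
    -- Condition on all samples except the batch with index `t`, which drives the move from `t` to
    -- `t + 1`; the state at time `t` does not depend on it.
    rw [expect_pi_update ⟨t, ht'⟩, Finset.mul_expect, ← Finset.expect_add_distrib]
    refine Finset.expect_le_expect fun J _ ↦ ?_
    have h : ∀ l : Fin b → Fin n, p (t + 1) (A, Function.update J ⟨t, ht'⟩ l)
        = innerStep f R T η (p t (A, J)) (List.ofFn l) := by
      intro l
      simp only [p]
      rw [epochState_succ _ _ _ ht', epochState_update _ _ _ _ _ _ le_rfl]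
      simp
    simp_rw [h]
    exact hA.expect_error_innerStep_le hcov hLl hθ hG hη.le hb (hseg _ t (by omega))

theorem Assumptions.expGradPow_two_le
    [IsContMDiffRiemannianBundle 𝓘(ℝ, E) ∞ E (fun x : M ↦ TangentSpace 𝓘(ℝ, E) x)] [NeZero n]
    (hcov : IsLeviCivita cov) (hA : Assumptions cov f R T X xs L Ll θ G σ)
    (hLl : 0 ≤ Ll) (hθ : 0 ≤ θ) (hG : 0 ≤ G) (hη : 0 < η) (hS : 0 < S)
    (hm : 0 < m) (hb : 0 < b) (hB : 0 < B) (hBn : B ≤ n)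
    (hsmall : (Ll + θ * G) ^ 2 * η ^ 2 / b * m + L * η ≤ 1) {x₀ : M}
    (hstay : StaysIn f R T η B m b S x₀ X) :
    expGradPow f R T η B m b S x₀ 2
      ≤ 2 * (avg f x₀ - avg f xs) / ((S * m : ℕ) * η) + (if B < n then σ ^ 2 / B else 0) := by
  have hnonempty : Nonempty (EpochSample n B m b) := by
    obtain ⟨A, -, hcard⟩ := Finset.exists_subset_card_eq (s := (Finset.univ : Finset (Fin n)))
      (n := B) (by simpa using hBn)
    exact ⟨⟨A, hcard⟩, fun _ _ ↦ ⟨0, NeZero.pos n⟩⟩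
  set V : ℝ := if B < n then σ ^ 2 / B else 0 with hV
  let z : (Fin S → EpochSample n B m b) → ℕ → M := fun κ s ↦ (snapshot f R T η x₀ κ s).1
  have hepoch : ∀ s : Fin S, 𝔼 κ : Fin S → EpochSample n B m b, ∑ t : Fin m,
        ‖grad (E := E) (avg f) (runState f R T η x₀ κ s t).point‖ ^ 2
      ≤ 2 / η * (𝔼 κ, avg f (z κ s) - 𝔼 κ, avg f (z κ (s + 1))) + m * V := by
    intro s
    -- Resampling only epoch `s` leaves its starting point fixed, so the one-epoch bound applies
    -- conditionally on the other epochs.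
    rw [expect_pi_update s, expect_pi_update s fun κ ↦ avg f (z κ (s + 1)),
      ← Finset.expect_sub_distrib, Finset.mul_expect,
      ← Fintype.expect_const (ι := Fin S → EpochSample n B m b) (m * V),
      ← Finset.expect_add_distrib]
    refine Finset.expect_le_expect fun κ _ ↦ ?_
    have h1 : ∀ (a : EpochSample n B m b) (t : Fin m),
        runState f R T η x₀ (Function.update κ s a) s t
          = epochState f R T η (z κ s) (snapshot f R T η x₀ κ s).2 a t := by
      intro a t
      simp only [runState, z]
      rw [snapshot_update _ _ _ _ le_rfl, Function.update_self]
    have h2 : ∀ a : EpochSample n B m b, z (Function.update κ s a) (s + 1)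
        = R.toFun (epochState f R T η (z κ s) (snapshot f R T η x₀ κ s).2 a (m - 1)).point
            ((epochState f R T η (z κ s) (snapshot f R T η x₀ κ s).2 a (m - 1)).step η) := by
      intro a
      change (snapshot f R T η x₀ (Function.update κ s a) (s + 1)).1 = _
      rw [snapshot_succ _ _ s.2, snapshot_update _ _ _ _ le_rfl, Fin.eta, Function.update_self]
    -- Rewriting is done on the real-valued function of the base point, since the gradients
    -- themselves lie in tangent spaces that vary with the point.
    have h3 : ∀ (a : EpochSample n B m b) (t : Fin m),
        ‖grad (E := E) (avg f) (runState f R T η x₀ (Function.update κ s a) s t).point‖ ^ 2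
          = ‖grad (E := E) (avg f)
            (epochState f R T η (z κ s) (snapshot f R T η x₀ κ s).2 a t).point‖ ^ 2 := fun a t ↦
      congrArg (fun y : M ↦ ‖grad (E := E) (avg f) y‖ ^ 2) (congrArg State.point (h1 a t))
    simp_rw [h3, h2]
    refine hA.expect_epoch_le hcov hLl hθ hG hη hm hb hB hBn hsmall fun a t ht ↦ ?_
    have h := hstay (Function.update κ s a) s ⟨t, ht⟩
    rwa [h1] at h
  have hlast : ∀ κ, z κ S ∈ X := by
    intro κ
    have h := (hstay κ ⟨S - 1, by omega⟩ ⟨m - 1, by omega⟩).right_mem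
    have hlt : S - 1 < S := by omega
    have hsucc := snapshot_succ (f := f) (R := R) (T := T) (η := η) x₀ κ hlt
    rw [show S - 1 + 1 = S by omega] at hsucc
    simp only [z, hsucc]
    exact h
  have hmin : avg f xs ≤ 𝔼 κ, avg f (z κ S) :=
    Finset.le_expect Finset.univ_nonempty fun κ _ ↦ hA.optimal (hlast κ)
  have htel : ∑ s : Fin S, (𝔼 κ, avg f (z κ s) - 𝔼 κ, avg f (z κ (s + 1)))
      = avg f x₀ - 𝔼 κ, avg f (z κ S) := by
    rw [Fin.sum_univ_eq_sum_range fun s ↦ 𝔼 κ, avg f (z κ s) - 𝔼 κ, avg f (z κ (s + 1)),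
      Finset.sum_range_sub' fun s ↦ 𝔼 κ, avg f (z κ s)]
    congr 1
    exact Fintype.expect_const (ι := Fin S → EpochSample n B m b) (avg f x₀)
  have htotal : 𝔼 κ : Fin S → EpochSample n B m b, ∑ s : Fin S, ∑ t : Fin m,
        ‖grad (E := E) (avg f) (runState f R T η x₀ κ s t).point‖ ^ 2
      ≤ 2 / η * (avg f x₀ - avg f xs) + S * (m * V) := by
    rw [Finset.expect_sum_comm]
    refine (Finset.sum_le_sum fun s _ ↦ hepoch s).trans ?_
    rw [Finset.sum_add_distrib, ← Finset.mul_sum, htel, Finset.sum_const, Finset.card_univ,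
      Fintype.card_fin, nsmul_eq_mul]
    gcongr
  have hSm : (0 : ℝ) < S * m := by positivity
  have hexp : expGradPow f R T η B m b S x₀ 2
      = (𝔼 κ : Fin S → EpochSample n B m b, ∑ s : Fin S, ∑ t : Fin m,
        ‖grad (E := E) (avg f) (runState f R T η x₀ κ s t).point‖ ^ 2) / (S * m) := by
    rw [expGradPow, expect_prod, Finset.expect_div]
    refine Finset.expect_congr rfl fun κ _ ↦ ?_
    rw [Fintype.expect_eq_sum_div_card, Fintype.sum_prod_type]
    rw [Fintype.card_prod, Fintype.card_fin, Fintype.card_fin, Nat.cast_mul]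
    rfl
  rw [hexp, div_le_iff₀ hSm]
  refine htotal.trans_eq ?_
  push_cast
  field_simp

end Runs
-- The bound on `η` is the positive root of `Q η² + L η = 1` in rationalized form, which also covers
-- `Q = 0`.
theorem mul_sq_add_mul_le_one {L Q η : ℝ} (hL : 0 < L) (hQ : 0 ≤ Q) (hη : 0 < η)
    (h : η ≤ 2 / (L + √(L ^ 2 + 4 * Q))) : Q * η ^ 2 + L * η ≤ 1 := by
  have hs := Real.sq_sqrt (by positivity : 0 ≤ L ^ 2 + 4 * Q)
  have hs0 := Real.sqrt_nonneg (L ^ 2 + 4 * Q)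
  set s := √(L ^ 2 + 4 * Q)
  rw [le_div_iff₀ (by positivity)] at h
  have h1 : (η * s) ^ 2 ≤ (2 - η * L) ^ 2 :=
    pow_le_pow_left₀ (by positivity) (by linarith) 2
  rw [mul_pow, hs] at h1
  linarith

theorem nat_le_two_mul_sqrt_mul_sqrt {n : ℕ} (hn : 0 < n) :
    (n : ℝ) ≤ 2 * Nat.sqrt n * √n := by
  have h1 : (1 : ℝ) ≤ Nat.sqrt n := by exact_mod_cast Nat.sqrt_pos.2 hn
  have h2 : √(n : ℝ) ≤ 2 * Nat.sqrt n := by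
    have := Real.real_sqrt_lt_nat_sqrt_succ (a := n)
    linarith
  calc (n : ℝ) = √n * √n := (Real.mul_self_sqrt (Nat.cast_nonneg n)).symm
    _ ≤ _ := mul_le_mul_of_nonneg_right h2 (Real.sqrt_nonneg _)

/-! ### From second moments and epoch counts to oracle complexity. -/

section Complexity

variable {E : Type u} [NormedAddCommGroup E] [NormedSpace ℝ E]
  {M : Type v} [TopologicalSpace M] [ChartedSpace E M] [IsManifold 𝓘(ℝ, E) ∞ M]
  [RiemannianBundle (fun x : M ↦ TangentSpace 𝓘(ℝ, E) x)] [FiniteDimensional ℝ E]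
  {n : ℕ} {f : Fin n → M → ℝ} {R : Retraction E M} {T : VectorTransport R}
  {X : Set M} {η : ℝ} {B m b S : ℕ} {x₀ : M}

theorem StaysIn.start_mem (h : StaysIn f R T η B m b S x₀ X) (hS : 0 < S) (hm : 0 < m)
    (hn : 0 < n) (hBn : B ≤ n) : x₀ ∈ X := by
  obtain ⟨A, -, hcard⟩ := Finset.exists_subset_card_eq (s := (Finset.univ : Finset (Fin n)))
    (n := B) (by simpa using hBn)
  exact (h (fun _ ↦ ⟨⟨A, hcard⟩, fun _ _ ↦ ⟨0, hn⟩⟩) ⟨0, hS⟩ ⟨0, hm⟩).left_mem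

theorem expGradPow_one_le {ε : ℝ} (hε : 0 ≤ ε) (h : expGradPow f R T η B m b S x₀ 2 ≤ ε ^ 2) :
    expGradPow f R T η B m b S x₀ 1 ≤ ε := by
  refine (abs_le_of_sq_le_sq' ?_ hε).2
  unfold expGradPow at h ⊢
  simp_rw [pow_one]
  exact (sq_expect_le _).trans h

theorem totalCalls_eq (κ : RunSample n B m b S) :
    totalCalls f R T η x₀ κ = S * (B + (m - 1) * (2 * b)) :=
  snapshot_calls x₀ κ.1 le_rfl

theorem totalCalls_le (κ : RunSample n B m m S) :
    (totalCalls f R T η x₀ κ : ℝ) ≤ S * (B + 2 * (m : ℝ) ^ 2) := by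
  have h : totalCalls f R T η x₀ κ ≤ S * (B + m * (2 * m)) := by
    rw [totalCalls_eq]
    gcongr
    exact Nat.sub_le m 1
  calc (totalCalls f R T η x₀ κ : ℝ) ≤ ((S * (B + m * (2 * m)) : ℕ) : ℝ) := by exact_mod_cast h
    _ = _ := by push_cast; ring

end Complexity

end RiemannianSRG

theorem mainTheorem1 :
    ∃ C : ℝ, 0 < C ∧
    ∀ {E : Type u} [NormedAddCommGroup E] [NormedSpace ℝ E] [FiniteDimensional ℝ E]
      {M : Type v} [TopologicalSpace M] [T2Space M] [SecondCountableTopology M]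
      [ChartedSpace E M] [IsManifold 𝓘(ℝ, E) ∞ M]
      [RiemannianBundle (fun x : M ↦ TangentSpace 𝓘(ℝ, E) x)]
      [IsContMDiffRiemannianBundle 𝓘(ℝ, E) ∞ E (fun x : M ↦ TangentSpace 𝓘(ℝ, E) x)]
      (cov : CovariantDerivative 𝓘(ℝ, E) E (fun x : M ↦ TangentSpace 𝓘(ℝ, E) x))
      (_ : RiemannianSRG.IsLeviCivita cov)
      (n : ℕ) (_ : 0 < n) (f : Fin n → M → ℝ)
      (R : RiemannianSRG.Retraction E M) (T : RiemannianSRG.VectorTransport R)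
      (X : Set M) (xs x₀ : M) (L Ll θ G σ : ℝ)
      (_ : 0 < L) (_ : 0 ≤ Ll) (_ : 0 ≤ θ) (_ : 0 ≤ G) (_ : 0 ≤ σ)
      (_ : RiemannianSRG.Assumptions cov f R T X xs L Ll θ G σ),
    let Δ : ℝ := RiemannianSRG.avg f x₀ - RiemannianSRG.avg f xs
    let Θ₂ : ℝ := L + √(L ^ 2 + 4 * (Ll + θ * G) ^ 2)
    -- convergence
    (∀ (S m b B : ℕ) (η : ℝ), 0 < S → 0 < m → 0 < b → 0 < B → B ≤ n → 0 < η →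
      η ≤ 2 / (L + √(L ^ 2 + 4 * ((Ll + θ * G) ^ 2 * m / b))) →
      RiemannianSRG.StaysIn f R T η B m b S x₀ X →
      RiemannianSRG.expGradPow f R T η B m b S x₀ 2
        ≤ 2 * Δ / ((S * m : ℕ) * η) + (if B < n then σ ^ 2 / B else 0)) ∧
    -- finite-sum complexity: `B = n`, `b = m = ⌊√n⌋`
    (∀ (ε : ℝ) (m : ℕ) (η : ℝ), 0 < ε → m = Nat.sqrt n → η = 2 / Θ₂ →
      (∀ S : ℕ, RiemannianSRG.StaysIn f R T η n m m S x₀ X) →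
      ∃ S : ℕ, 0 < S ∧
        RiemannianSRG.expGradPow f R T η n m m S x₀ 1 ≤ ε ∧
        ∀ κ : RiemannianSRG.RunSample n n m m S,
          (RiemannianSRG.totalCalls f R T η x₀ κ : ℝ) ≤ C * (n + Δ * Θ₂ * √n / ε ^ 2)) ∧
    -- online complexity: `B = 2σ²/ε²`, `b = m = σ/ε`, rounded up
    (∀ (ε : ℝ) (m B : ℕ) (η : ℝ), 0 < ε → ε ≤ σ → m = ⌈σ / ε⌉₊ → B = ⌈2 * σ ^ 2 / ε ^ 2⌉₊ →
      B ≤ n → η = 2 / Θ₂ →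
      (∀ S : ℕ, RiemannianSRG.StaysIn f R T η B m m S x₀ X) →
      ∃ S : ℕ, 0 < S ∧
        RiemannianSRG.expGradPow f R T η B m m S x₀ 1 ≤ ε ∧
        ∀ κ : RiemannianSRG.RunSample n B m m S,
          (RiemannianSRG.totalCalls f R T η x₀ κ : ℝ)
            ≤ C * (σ ^ 2 / ε ^ 2 + Δ * Θ₂ * σ / ε ^ 3) ∧
          (σ * ε ≤ Δ * Θ₂ →
            (RiemannianSRG.totalCalls f R T η x₀ κ : ℝ) ≤ C * (Δ * Θ₂ * σ / ε ^ 3))) := by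
  -- `44 = 22 + 22` comes from the online case, when both terms of the bound are merged; the
  -- finite-sum case needs only 6.
  refine ⟨44, by norm_num, ?_⟩
  intro E _ _ _ M _ _ _ _ _ _ _ cov hcov n hn f R T X xs x₀ L Ll θ G σ hL hLl hθ hG hσ hA Δ Θ₂
  have : NeZero n := ⟨hn.ne'⟩
  have hΘ : 0 < Θ₂ := by positivity
  have hΔ : x₀ ∈ X → 0 ≤ Δ := fun hx ↦ sub_nonneg.2 (hA.optimal hx)
  have part₁ : ∀ (S m b B : ℕ) (η : ℝ), 0 < S → 0 < m → 0 < b → 0 < B → B ≤ n → 0 < η →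
      η ≤ 2 / (L + √(L ^ 2 + 4 * ((Ll + θ * G) ^ 2 * m / b))) →
      RiemannianSRG.StaysIn f R T η B m b S x₀ X →
      RiemannianSRG.expGradPow f R T η B m b S x₀ 2
        ≤ 2 * Δ / ((S * m : ℕ) * η) + (if B < n then σ ^ 2 / B else 0) := by
    intro S m b B η hS hm hb hB hBn hη hstep hstay
    refine hA.expGradPow_two_le hcov hLl hθ hG hη hS hm hb hB hBn ?_ hstay
    refine le_trans (le_of_eq ?_) (RiemannianSRG.mul_sq_add_mul_le_one hL (by positivity) hη hstep)
    ring
  have part₁' : ∀ (S m B : ℕ), 0 < S → 0 < m → 0 < B → B ≤ n →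
      RiemannianSRG.StaysIn f R T (2 / Θ₂) B m m S x₀ X →
      RiemannianSRG.expGradPow f R T (2 / Θ₂) B m m S x₀ 2
        ≤ Δ * Θ₂ / (S * m) + (if B < n then σ ^ 2 / B else 0) := by
    intro S m B hS hm hB hBn hstay
    have hm' : (m : ℝ) ≠ 0 := by positivity
    have hS' : (S : ℝ) ≠ 0 := by positivity
    refine (part₁ S m m B (2 / Θ₂) hS hm hm hB hBn (by positivity) ?_ hstay).trans_eq ?_
    · rw [mul_div_assoc, div_self hm', mul_one]
    · congr 1
      push_cast
      field_simp
  refine ⟨part₁, ?_, ?_⟩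
  · intro ε m η hε hm hη hstay
    subst hη
    have hmpos : 0 < m := hm ▸ Nat.sqrt_pos.2 hn
    have hm' : (0 : ℝ) < m := by exact_mod_cast hmpos
    have hΔ' : 0 ≤ Δ := hΔ ((hstay 1).start_mem one_pos hmpos hn le_rfl)
    -- The real number of epochs at which `Δ Θ₂ / (S m)` equals `ε²`. Taking `⌈y⌉₊ + 1` keeps `S`
    -- positive even when `Δ = 0`.
    set y : ℝ := Δ * Θ₂ / (m * ε ^ 2) with hy
    have hy0 : 0 ≤ y := by positivity
    refine ⟨⌈y⌉₊ + 1, Nat.succ_pos _, ?_, fun κ ↦ ?_⟩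
    · refine RiemannianSRG.expGradPow_one_le hε.le
        ((part₁' _ m n (Nat.succ_pos _) hmpos hn le_rfl (hstay _)).trans ?_)
      rw [if_neg (lt_irrefl n), add_zero, div_le_iff₀ (by positivity)]
      have hle : y ≤ ((⌈y⌉₊ + 1 : ℕ) : ℝ) := by
        push_cast
        linarith [Nat.le_ceil y]
      calc Δ * Θ₂ = y * (m * ε ^ 2) := by rw [hy]; field_simp
        _ ≤ ((⌈y⌉₊ + 1 : ℕ) : ℝ) * (m * ε ^ 2) := by gcongr
        _ = _ := by ring
    · refine (RiemannianSRG.totalCalls_le κ).trans ?_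
      have hS : ((⌈y⌉₊ + 1 : ℕ) : ℝ) ≤ y + 2 := by
        push_cast
        linarith [Nat.ceil_lt_add_one hy0]
      have hm2 : (m : ℝ) ^ 2 ≤ n := by
        have := Nat.sqrt_le' n
        rw [← hm] at this
        exact_mod_cast this
      have hnm : (n : ℝ) ≤ 2 * m * √n := hm ▸ RiemannianSRG.nat_le_two_mul_sqrt_mul_sqrt hn
      have hny : n * y ≤ 2 * (Δ * Θ₂ * √n / ε ^ 2) := by
        calc n * y ≤ 2 * m * √n * y := by gcongr
          _ = _ := by rw [hy]; field_simp
      have hterm : 0 ≤ Δ * Θ₂ * √n / ε ^ 2 := by positivity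
      calc _ ≤ (y + 2) * (n + 2 * (n : ℝ)) := by gcongr
        _ = 3 * (n * y) + 6 * n := by ring
        _ ≤ _ := by linarith [(Nat.cast_nonneg n : (0 : ℝ) ≤ n)]
  · intro ε m B η hε hεσ hm hB hBn hη hstay
    subst hη
    have hσ' : 0 < σ := hε.trans_le hεσ
    have hmpos : 0 < m := hm ▸ Nat.ceil_pos.2 (by positivity)
    have hBpos : 0 < B := hB ▸ Nat.ceil_pos.2 (by positivity)
    have hm' : (0 : ℝ) < m := by exact_mod_cast hmpos
    have hB' : (0 : ℝ) < B := by exact_mod_cast hBpos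
    have hΔ' : 0 ≤ Δ := hΔ ((hstay 1).start_mem one_pos hmpos hn hBn)
    have hq : 1 ≤ σ / ε := (one_le_div hε).2 hεσ
    have hmlow : σ / ε ≤ m := hm ▸ Nat.le_ceil _
    have hmup : (m : ℝ) ≤ 2 * (σ / ε) := by
      have := Nat.ceil_lt_add_one (by positivity : 0 ≤ σ / ε)
      rw [← hm] at this
      linarith
    have hq2 : σ ^ 2 / ε ^ 2 = (σ / ε) ^ 2 := (div_pow σ ε 2).symm
    have hBlow : 2 * σ ^ 2 / ε ^ 2 ≤ B := hB ▸ Nat.le_ceil _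
    -- Rounding up costs at most 1, which is absorbed because `σ / ε ≥ 1`.
    have hBup : (B : ℝ) ≤ 3 * (σ / ε) ^ 2 := by
      have := Nat.ceil_lt_add_one (by positivity : 0 ≤ 2 * σ ^ 2 / ε ^ 2)
      rw [← hB, mul_div_assoc, hq2] at this
      nlinarith
    -- Twice the finite-sum value: the optimization term gets `ε²/2`, and the choice of `B` leaves
    -- the batch variance the other half.
    set y : ℝ := 2 * (Δ * Θ₂) / (m * ε ^ 2) with hy
    have hy0 : 0 ≤ y := by positivity
    refine ⟨⌈y⌉₊ + 1, Nat.succ_pos _, ?_, fun κ ↦ ?_⟩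
    · refine RiemannianSRG.expGradPow_one_le hε.le
        ((part₁' _ m B (Nat.succ_pos _) hmpos hBpos hBn (hstay _)).trans ?_)
      have hle : y ≤ ((⌈y⌉₊ + 1 : ℕ) : ℝ) := by
        push_cast
        linarith [Nat.le_ceil y]
      have h1 : Δ * Θ₂ / (((⌈y⌉₊ + 1 : ℕ) : ℝ) * m) ≤ ε ^ 2 / 2 := by
        rw [div_le_iff₀ (by positivity)]
        calc Δ * Θ₂ = y * (m * ε ^ 2 / 2) := by rw [hy]; field_simp
          _ ≤ ((⌈y⌉₊ + 1 : ℕ) : ℝ) * (m * ε ^ 2 / 2) := by gcongr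
          _ = _ := by ring
      have h2 : (if B < n then σ ^ 2 / B else 0) ≤ ε ^ 2 / 2 := by
        split_ifs
        · rw [div_le_iff₀ (by positivity)] at hBlow ⊢
          linarith
        · positivity
      linarith
    · have hS : ((⌈y⌉₊ + 1 : ℕ) : ℝ) ≤ y + 2 := by
        push_cast
        linarith [Nat.ceil_lt_add_one hy0]
      have hyup : y * (σ / ε) ^ 2 ≤ 2 * (Δ * Θ₂ * σ / ε ^ 3) := by
        calc y * (σ / ε) ^ 2 ≤ 2 * (Δ * Θ₂) / (σ / ε * ε ^ 2) * (σ / ε) ^ 2 := by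
              rw [hy]
              gcongr
          _ = _ := by field_simp
      have hcalls : (RiemannianSRG.totalCalls f R T (2 / Θ₂) x₀ κ : ℝ)
          ≤ 22 * (σ / ε) ^ 2 + 22 * (Δ * Θ₂ * σ / ε ^ 3) := by
        calc _ ≤ _ := RiemannianSRG.totalCalls_le κ
          _ ≤ (y + 2) * (3 * (σ / ε) ^ 2 + 2 * (2 * (σ / ε)) ^ 2) := by gcongr
          _ = 11 * (y * (σ / ε) ^ 2) + 22 * (σ / ε) ^ 2 := by ring
          _ ≤ _ := by linarith
      have hterm : 0 ≤ Δ * Θ₂ * σ / ε ^ 3 := by positivity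
      refine ⟨hcalls.trans ?_, fun hlarge ↦ hcalls.trans ?_⟩
      · rw [hq2]
        linarith [sq_nonneg (σ / ε)]
      -- When `σ ε ≤ Δ Θ₂`, the cost of the constant number of extra epochs is dominated by the main
      -- term.
      · have : (σ / ε) ^ 2 ≤ Δ * Θ₂ * σ / ε ^ 3 := by
          calc (σ / ε) ^ 2 = σ * ε * σ / ε ^ 3 := by field_simp
            _ ≤ _ := by gcongr
        linarith
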